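/- Let $X(u,v)=\left(\cos\frac u2\cos\frac v2,\ \cos\frac u2\sin\frac v2,\ \sin\frac u2\cos\frac v2,\ \sin\frac u2\sin\frac v2\right)$ be the standard parametrization, in homogeneous coordinates $(x_0,x_1,x_2,x_3)$, of the hyperboloid $x_0x_3=x_1x_2$ in $\mathbb{RP}^3$ by the torus $\mathbb T^2=(\mathbb R/2\pi\mathbb Z)^2$, and let $X_{uv}=\partial^2X/\partial u\,\partial v$. For a smooth ($C^\infty$) function $f:\mathbb T^2\to\mathbb R$ and $\varepsilon\in\mathbb R$ let $M_\varepsilon\subset\mathbb{RP}^3$ be the surface parametrized by $$\widetilde X(u,v)=X(u,v)+\varepsilon f(u,v)\,X_{uv}(u,v).$$ A point $m$ of a surface $M\subset\mathbb{RP}^3$ is called quadratic if $M$ is approximated at $m$ by a non-degenerate quadric up to order 3, i.e. there is a non-degenerate quadratic form $Q$ on $\mathbb R^4$ whose restriction to $M$ (in local homogeneous coordinates) vanishes at $m$ up to terms of order at least 4. Consider the system $$f_{uuu}+f_u=0,\qquad f_{vvv}+f_v=0 \qquad (*)$$ on $\mathbb T^2$, and call $f$ generic if every solution of $(*)$ is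 simple, i.e. the Jacobian determinant of the map $(u,v)\mapsto(f_{uuu}+f_u,\ f_{vvv}+f_v)$ is non-zero at every solution of $(*)$. The generic functions form an open and dense subset of $C^\infty(\mathbb T^2)$ in the $C^\infty$ topology. For every generic $f$, the system $(*)$ has finitely many solutions on $\mathbb T^2$, and there is $\varepsilon_0>0$ such that for every $\varepsilon$ with $0<|\varepsilon|\le\varepsilon_0$ the number of quadratic points on $M_\varepsilon$ equals the number of solutions of $(*)$ on $\mathbb T^2$. -/

import Mathlib

open scoped ContDiff LinearAlgebra.Projectivization
open Filter Topology Asymptotics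

namespace HyperboloidPerturbation

/-- Smooth real functions on the torus `(ℝ / 2πℤ)²`, as smooth functions of `(u, v)` that are
`2π`-periodic in each variable. -/
structure SmoothTorusFunction where
  toFun : ℝ × ℝ → ℝ
  smooth : ContDiff ℝ ∞ toFun
  periodic_fst : ∀ u v : ℝ, toFun (u + 2 * Real.pi, v) = toFun (u, v)
  periodic_snd : ∀ u v : ℝ, toFun (u, v + 2 * Real.pi) = toFun (u, v)

/-- The `C^∞` topology: uniform convergence of the derivatives of every order. -/
noncomputable instance : TopologicalSpace SmoothTorusFunction :=
  TopologicalSpace.induced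
    (fun (f : SmoothTorusFunction) (k : ℕ) => UniformFun.ofFun (iteratedFDeriv ℝ k f.toFun))
    inferInstance

/-- `f_uuu + f_u`. -/
noncomputable def operatorU (f : ℝ × ℝ → ℝ) (p : ℝ × ℝ) : ℝ :=
  iteratedDeriv 3 (fun s : ℝ => f (s, p.2)) p.1 + deriv (fun s : ℝ => f (s, p.2)) p.1

/-- `f_vvv + f_v`. -/
noncomputable def operatorV (f : ℝ × ℝ → ℝ) (p : ℝ × ℝ) : ℝ :=
  iteratedDeriv 3 (fun t : ℝ => f (p.1, t)) p.2 + deriv (fun t : ℝ => f (p.1, t)) p.2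

/-- The solutions on the torus, represented by `[0, 2π) × [0, 2π)`, of the system
`f_uuu + f_u = 0`, `f_vvv + f_v = 0`. -/
def solutionSet (f : ℝ × ℝ → ℝ) : Set (ℝ × ℝ) :=
  {p | p ∈ Set.Ico 0 (2 * Real.pi) ×ˢ Set.Ico 0 (2 * Real.pi) ∧
    operatorU f p = 0 ∧ operatorV f p = 0}

/-- All solutions of the system are simple (of multiplicity one): the Jacobian determinant of
`(f_uuu + f_u, f_vvv + f_v)` does not vanish at any of them. -/
def HasSimpleSolutions (f : ℝ × ℝ → ℝ) : Prop :=
  ∀ p ∈ solutionSet f,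
    (fderiv ℝ (fun q : ℝ × ℝ => (operatorU f q, operatorV f q)) p).det ≠ 0

/-- Homogeneous coordinates of the standard parametrization of the hyperboloid
`x₀ x₃ = x₁ x₂` in the projective space. -/
noncomputable def hyperboloidParam (u v : ℝ) : Fin 4 → ℝ :=
  ![Real.cos (u / 2) * Real.cos (v / 2), Real.cos (u / 2) * Real.sin (v / 2),
    Real.sin (u / 2) * Real.cos (v / 2), Real.sin (u / 2) * Real.sin (v / 2)]

/-- The transversal vector `X_uv = ∂²X / ∂u ∂v` of the hyperboloid. -/
noncomputable def hyperboloidNormal (u v : ℝ) : Fin 4 → ℝ :=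
  deriv (fun s : ℝ => deriv (fun t : ℝ => hyperboloidParam s t) v) u

theorem hyperboloidNormal_eq (u v : ℝ) :
    hyperboloidNormal u v =
      ![(1 / 4) * (Real.sin (u / 2) * Real.sin (v / 2)),
        (1 / 4) * (-(Real.sin (u / 2) * Real.cos (v / 2))),
        (1 / 4) * (-(Real.cos (u / 2) * Real.sin (v / 2))),
        (1 / 4) * (Real.cos (u / 2) * Real.cos (v / 2))] := by
  have hc : ∀ x : ℝ, HasDerivAt (fun t : ℝ => Real.cos (t / 2)) (-Real.sin (x / 2) * (1 / 2)) x :=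
    fun x => ((hasDerivAt_id x).div_const 2).cos
  have hs : ∀ x : ℝ, HasDerivAt (fun t : ℝ => Real.sin (t / 2)) (Real.cos (x / 2) * (1 / 2)) x :=
    fun x => ((hasDerivAt_id x).div_const 2).sin
  have h1 : ∀ s : ℝ, deriv (fun t : ℝ => hyperboloidParam s t) v =
      ![Real.cos (s / 2) * (-Real.sin (v / 2) * (1 / 2)),
        Real.cos (s / 2) * (Real.cos (v / 2) * (1 / 2)),
        Real.sin (s / 2) * (-Real.sin (v / 2) * (1 / 2)),
        Real.sin (s / 2) * (Real.cos (v / 2) * (1 / 2))] := by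
    intro s
    apply HasDerivAt.deriv
    rw [hasDerivAt_pi]
    intro i
    fin_cases i
    · exact (hc v).const_mul _
    · exact (hs v).const_mul _
    · exact (hc v).const_mul _
    · exact (hs v).const_mul _
  unfold hyperboloidNormal
  simp only [h1]
  apply HasDerivAt.deriv
  rw [hasDerivAt_pi]
  intro i
  fin_cases i
  · exact ((hc u).mul_const _).congr_deriv (by simp; ring)
  · exact ((hc u).mul_const _).congr_deriv (by simp; ring)
  · exact ((hs u).mul_const _).congr_deriv (by simp; ring)
  · exact ((hs u).mul_const _).congr_deriv (by simp; ring)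

/-- Homogeneous coordinates of the perturbed surface, `X + ε f X_uv`. -/
noncomputable def perturbedParam (f : ℝ × ℝ → ℝ) (ε u v : ℝ) : Fin 4 → ℝ :=
  hyperboloidParam u v + (ε * f (u, v)) • hyperboloidNormal u v

theorem perturbedParam_ne_zero (f : ℝ × ℝ → ℝ) (ε u v : ℝ) : perturbedParam f ε u v ≠ 0 := by
  intro h
  have h1 : perturbedParam f ε u v ⬝ᵥ hyperboloidParam u v = 1 := by
    have e1 := Real.sin_sq_add_cos_sq (u / 2)
    have e2 := Real.sin_sq_add_cos_sq (v / 2)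
    simp only [perturbedParam, hyperboloidNormal_eq, hyperboloidParam, dotProduct,
      Fin.sum_univ_four, Pi.add_apply, Pi.smul_apply, smul_eq_mul, Matrix.cons_val]
    linear_combination (Real.sin (v / 2) ^ 2 + Real.cos (v / 2) ^ 2) * e1 + e2
  rw [h, zero_dotProduct] at h1
  exact zero_ne_one h1

/-- The surface `M_ε` in the real projective space, the image of `(u, v) ↦ [X + ε f X_uv]`. -/
def perturbedSurface (f : ℝ × ℝ → ℝ) (ε : ℝ) : Set (ℙ ℝ (Fin 4 → ℝ)) :=
  Set.range fun p : ℝ × ℝ =>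
    Projectivization.mk ℝ (perturbedParam f ε p.1 p.2) (perturbedParam_ne_zero f ε p.1 p.2)

/-- The punctured cone over a subset of the projective space. -/
def puncturedCone (M : Set (ℙ ℝ (Fin 4 → ℝ))) : Set (Fin 4 → ℝ) :=
  {y | ∃ hy : y ≠ 0, Projectivization.mk ℝ y hy ∈ M}

/-- A quadratic point of a surface `M`: a point `m` of `M` at which some non-degenerate quadric
`Q = 0` approximates `M` up to order three, that is, `Q` restricted to `M` is `O(4)` at `m`.
This is expressed on the cone over `M`; by homogeneity the representative of `m` is immaterial. -/
def IsQuadraticPoint (M : Set (ℙ ℝ (Fin 4 → ℝ))) (m : ℙ ℝ (Fin 4 → ℝ)) : Prop :=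
  m ∈ M ∧ ∃ Q : QuadraticForm ℝ (Fin 4 → ℝ),
    (QuadraticMap.associated (R := ℝ) Q).Nondegenerate ∧
    (fun y => Q y) =O[𝓝[puncturedCone M] m.rep] fun y => ‖y - m.rep‖ ^ 4

end HyperboloidPerturbation

/-!
A point of the perturbed surface `M_ε` is quadratic exactly when two explicit functions of the
`3`-jet of `ε f / 4` vanish there. To first order in `ε` these functions are
`ε (f_uuu + f_u) / 3` and `ε (f_vvv + f_v) / 3`, so that after division by `ε` the quadratic points
become the zeros of a smooth perturbation of the system `f_uuu + f_u = f_vvv + f_v = 0`; on the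
compact torus simple zeros persist and are neither created nor destroyed.

*The local condition.* A rotation of the homogeneous coordinates and the substitution
`x = tan ((u - u₀) / 2)`, `y = tan ((v - v₀) / 2)` turn the hyperboloid into `(1, y, x, x y)` and
`M_ε` into `(1 + g x y, y - g x, x - g y, x y + g)` with `g = ε f / 4`. In coordinates adapted to
the tangent plane (`Jet.adapted`) the surface is the graph of the last coordinate over the two
middle ones, and the equations of order two and three for an approximating quadric say that the
cubic form of the graph is a linear form times its second fundamental form. The latter is close to
`x y`, so Cramer's rule in the two middle coefficients determines the linear form, and the two outer
coefficients give the two conditions: `Jet.exists_matrix_isBigO_iff`, `isQuadraticPoint_iff`. The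
Taylor coefficients in `x`, `y` are found from those in `u`, `v` (`hasJet_comp_tanChart`); the
cubic term of `arctan` and the product of `f_u` with the second fundamental form `x y` together
complete `f_uuu` to a multiple of `f_uuu + f_u` (`reducedX_zero`).

*From the cone to the parameters.* Quadratic points are defined by the order of vanishing on the
cone over `M_ε`, which is compared with the order of vanishing in `(u, v)` by an explicit Lipschitz
inverse of the parametrization. As a `2 × 2` matrix, the representative of the point with
parameters `(u, v)` has `(cos (u / 2), sin (u / 2))` and `(cos (v / 2), sin (v / 2))` as left and
right singular vectors for the singular value `1`, the other singular value being `|g|`; hence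
quadratic expressions in the homogeneous coordinates give `exp (i u)` and `exp (i v)`
up to positive factors as long as `|g| < 1` (`directionU`, `directionV`). The same
expressions show that distinct points of the torus give distinct points of `M_ε`.

*Counting.* The inverse function theorem for `(ε, p) ↦ (ε, H (ε, p))` continues each simple zero
uniquely for small `ε`, and compactness of the torus excludes other zeros
(`finite_and_eventually_encard_eq`).

*Generic functions.* Whether `f` is generic depends on its derivatives up to order four on a
compact set, through an open condition, whence openness. For density, add to `f` a combination of
`cos 2u`, `sin 2u`, `cos 2v`, `sin 2v`. The pairs of a coefficient vector and a solution of the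
perturbed system are parametrized by `(p, t)` in `ℝ² × ℝ²`, and a non-simple solution is a critical
point of the map `zeroParam` from `(p, t)` to the coefficients. The equidimensional case of Sard's
theorem therefore provides arbitrarily small perturbations all of whose solutions are simple.
-/

namespace HyperboloidPerturbation

/-! ### Partial derivatives -/

/-- The partial derivative `∂f/∂u`. -/
noncomputable def partialU (f : ℝ × ℝ → ℝ) (p : ℝ × ℝ) : ℝ := fderiv ℝ f p (1, 0)

/-- The partial derivative `∂f/∂v`. -/
noncomputable def partialV (f : ℝ × ℝ → ℝ) (p : ℝ × ℝ) : ℝ := fderiv ℝ f p (0, 1)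

section PartialDerivatives

variable {f g : ℝ × ℝ → ℝ}

theorem contDiff_partialU (hf : ContDiff ℝ ∞ f) : ContDiff ℝ ∞ (partialU f) :=
  (hf.fderiv_right (m := ∞) (by simp)).clm_apply contDiff_const

theorem contDiff_partialV (hf : ContDiff ℝ ∞ f) : ContDiff ℝ ∞ (partialV f) :=
  (hf.fderiv_right (m := ∞) (by simp)).clm_apply contDiff_const

theorem fderiv_apply_eq_partial (f : ℝ × ℝ → ℝ) (p w : ℝ × ℝ) :
    fderiv ℝ f p w = w.1 * partialU f p + w.2 * partialV f p := by
  have hw : w = w.1 • ((1, 0) : ℝ × ℝ) + w.2 • ((0, 1) : ℝ × ℝ) := by ext <;> simp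
  conv_lhs => rw [hw]
  rw [map_add, map_smul, map_smul]
  rfl

theorem partialU_partialV_comm (hf : ContDiff ℝ ∞ f) (p : ℝ × ℝ) :
    partialU (partialV f) p = partialV (partialU f) p := by
  have hd : DifferentiableAt ℝ (fderiv ℝ f) p :=
    (hf.fderiv_right (m := ∞) (by simp)).differentiable (by simp) p
  have h (x y : ℝ × ℝ) : fderiv ℝ (fun q => fderiv ℝ f q x) p y = fderiv ℝ (fderiv ℝ f) p y x := by
    rw [fderiv_clm_apply hd (by fun_prop)]
    simp
  have hs : IsSymmSndFDerivAt ℝ f p :=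
    hf.contDiffAt.isSymmSndFDerivAt (by simpa using WithTop.coe_le_coe.2 (le_top (a := (2 : ℕ∞))))
  unfold partialU partialV
  rw [h, h]
  exact hs _ _

theorem hasDerivAt_partialU (hf : ContDiff ℝ ∞ f) (p : ℝ × ℝ) :
    HasDerivAt (fun s => f (s, p.2)) (partialU f p) p.1 := by
  have h1 : HasFDerivAt f (fderiv ℝ f p) (p.1, p.2) := (hf.differentiable (by simp) p).hasFDerivAt
  exact h1.comp_hasDerivAt p.1 ((hasDerivAt_id p.1).prodMk (hasDerivAt_const p.1 p.2))

theorem hasDerivAt_partialV (hf : ContDiff ℝ ∞ f) (p : ℝ × ℝ) :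
    HasDerivAt (fun t => f (p.1, t)) (partialV f p) p.2 := by
  have h1 : HasFDerivAt f (fderiv ℝ f p) (p.1, p.2) := (hf.differentiable (by simp) p).hasFDerivAt
  exact h1.comp_hasDerivAt p.2 ((hasDerivAt_const p.2 p.1).prodMk (hasDerivAt_id p.2))

theorem operatorU_eq (hf : ContDiff ℝ ∞ f) (p : ℝ × ℝ) :
    operatorU f p = partialU (partialU (partialU f)) p + partialU f p := by
  have key {g : ℝ × ℝ → ℝ} (hg : ContDiff ℝ ∞ g) :
      deriv (fun s : ℝ => g (s, p.2)) = fun s => partialU g (s, p.2) :=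
    funext fun s => (hasDerivAt_partialU hg (s, p.2)).deriv
  unfold operatorU
  rw [iteratedDeriv_succ', iteratedDeriv_succ', iteratedDeriv_one, key hf,
    key (contDiff_partialU hf), key (contDiff_partialU (contDiff_partialU hf))]

theorem operatorV_eq (hf : ContDiff ℝ ∞ f) (p : ℝ × ℝ) :
    operatorV f p = partialV (partialV (partialV f)) p + partialV f p := by
  have key {g : ℝ × ℝ → ℝ} (hg : ContDiff ℝ ∞ g) :
      deriv (fun t : ℝ => g (p.1, t)) = fun t => partialV g (p.1, t) :=
    funext fun t => (hasDerivAt_partialV hg (p.1, t)).deriv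
  unfold operatorV
  rw [iteratedDeriv_succ', iteratedDeriv_succ', iteratedDeriv_one, key hf,
    key (contDiff_partialV hf), key (contDiff_partialV (contDiff_partialV hf))]

theorem contDiff_operatorU (hf : ContDiff ℝ ∞ f) : ContDiff ℝ ∞ (operatorU f) := by
  rw [funext (operatorU_eq hf)]
  exact (contDiff_partialU (contDiff_partialU (contDiff_partialU hf))).add (contDiff_partialU hf)

theorem contDiff_operatorV (hf : ContDiff ℝ ∞ f) : ContDiff ℝ ∞ (operatorV f) := by
  rw [funext (operatorV_eq hf)]
  exact (contDiff_partialV (contDiff_partialV (contDiff_partialV hf))).add (contDiff_partialV hf)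

/-- Taylor estimates are obtained one order at a time, by integrating the partial derivatives. -/
theorem isBigO_pow_succ_of_partial {k : ℕ} (hf : ContDiff ℝ ∞ f) (h0 : f 0 = 0)
    (hu : partialU f =O[𝓝 0] fun w : ℝ × ℝ => ‖w‖ ^ k)
    (hv : partialV f =O[𝓝 0] fun w : ℝ × ℝ => ‖w‖ ^ k) :
    f =O[𝓝 0] fun w : ℝ × ℝ => ‖w‖ ^ (k + 1) := by
  obtain ⟨C₁, hC₁⟩ := hu.bound
  obtain ⟨C₂, hC₂⟩ := hv.bound
  obtain ⟨r, hr, hball⟩ := Metric.eventually_nhds_iff_ball.1 (hC₁.and hC₂)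
  refine IsBigO.of_bound (C₁ + C₂) ?_
  filter_upwards [Metric.ball_mem_nhds (0 : ℝ × ℝ) hr] with w hw
  have hw' : ‖w‖ < r := by simpa using hw
  have hbound : ∀ z ∈ Metric.closedBall (0 : ℝ × ℝ) ‖w‖, ‖fderiv ℝ f z‖ ≤ (C₁ + C₂) * ‖w‖ ^ k := by
    intro z hz
    have hz' : ‖z‖ ≤ ‖w‖ := by simpa using hz
    obtain ⟨h1, h2⟩ := hball z (by simpa using hz'.trans_lt hw')
    rw [norm_pow, norm_norm] at h1 h2
    have hk : ‖z‖ ^ k ≤ ‖w‖ ^ k := by gcongr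
    have hk0 : 0 ≤ ‖z‖ ^ k := by positivity
    have h3 : ‖partialU f z‖ + ‖partialV f z‖ ≤ (C₁ + C₂) * ‖w‖ ^ k := by
      rcases hk0.eq_or_lt with h | h
      · rw [← h, mul_zero] at h1 h2
        have hu' := norm_nonneg (partialU f w)
        have hv' := norm_nonneg (partialV f w)
        obtain ⟨h4, h5⟩ := hball w hw
        rw [norm_pow, norm_norm] at h4 h5
        linarith
      · have : 0 ≤ C₁ + C₂ := by
          by_contra hneg
          have := norm_nonneg (partialU f z)
          have := norm_nonneg (partialV f z)
          nlinarith
        nlinarith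
    refine ContinuousLinearMap.opNorm_le_bound _ ((by positivity : (0 : ℝ) ≤ _).trans h3)
      fun y => ?_
    rw [fderiv_apply_eq_partial]
    have hy1 : ‖y.1‖ ≤ ‖y‖ := norm_fst_le y
    have hy2 : ‖y.2‖ ≤ ‖y‖ := norm_snd_le y
    calc ‖y.1 * partialU f z + y.2 * partialV f z‖
        ≤ ‖y.1‖ * ‖partialU f z‖ + ‖y.2‖ * ‖partialV f z‖ := by
          rw [← norm_mul, ← norm_mul]; exact norm_add_le _ _
      _ ≤ ‖y‖ * ‖partialU f z‖ + ‖y‖ * ‖partialV f z‖ := by gcongr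
      _ = (‖partialU f z‖ + ‖partialV f z‖) * ‖y‖ := by ring
      _ ≤ _ := by gcongr
  have := (convex_closedBall (0 : ℝ × ℝ) ‖w‖).norm_image_sub_le_of_norm_fderiv_le
    (fun z _ => hf.differentiable (by simp) z) hbound
    (Metric.mem_closedBall_self (norm_nonneg w)) (by simp : w ∈ Metric.closedBall (0 : ℝ × ℝ) ‖w‖)
  rw [h0, sub_zero, sub_zero] at this
  calc ‖f w‖ ≤ _ := this
    _ = _ := by rw [norm_pow, norm_norm]; ring

end PartialDerivatives

/-! ### Third order jets of functions of two variables -/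

/-- The coefficients of a polynomial in `x`, `y` of degree at most three; `cij` is the coefficient
of `x ^ i * y ^ j`. -/
@[ext]
structure Jet where
  c00 : ℝ
  c10 : ℝ
  c01 : ℝ
  c20 : ℝ
  c11 : ℝ
  c02 : ℝ
  c30 : ℝ
  c21 : ℝ
  c12 : ℝ
  c03 : ℝ

namespace Jet

/-- The homogeneous part of degree one. -/
def h1 (J : Jet) (w : ℝ × ℝ) : ℝ := J.c10 * w.1 + J.c01 * w.2

/-- The homogeneous part of degree two. -/
def h2 (J : Jet) (w : ℝ × ℝ) : ℝ := J.c20 * w.1 ^ 2 + J.c11 * (w.1 * w.2) + J.c02 * w.2 ^ 2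

/-- The homogeneous part of degree three. -/
def h3 (J : Jet) (w : ℝ × ℝ) : ℝ :=
  J.c30 * w.1 ^ 3 + J.c21 * (w.1 ^ 2 * w.2) + J.c12 * (w.1 * w.2 ^ 2) + J.c03 * w.2 ^ 3

/-- The value of the polynomial. -/
def eval (J : Jet) (w : ℝ × ℝ) : ℝ := J.c00 + J.h1 w + J.h2 w + J.h3 w

/-- Constant polynomials. -/
def const (a : ℝ) : Jet := ⟨a, 0, 0, 0, 0, 0, 0, 0, 0, 0⟩

/-- The sum of two polynomials. -/
def add (J K : Jet) : Jet :=
  ⟨J.c00 + K.c00, J.c10 + K.c10, J.c01 + K.c01, J.c20 + K.c20, J.c11 + K.c11, J.c02 + K.c02,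
    J.c30 + K.c30, J.c21 + K.c21, J.c12 + K.c12, J.c03 + K.c03⟩

/-- The product of two polynomials, truncated after degree three. -/
def mul (J K : Jet) : Jet :=
  ⟨J.c00 * K.c00,
    J.c00 * K.c10 + J.c10 * K.c00,
    J.c00 * K.c01 + J.c01 * K.c00,
    J.c00 * K.c20 + J.c10 * K.c10 + J.c20 * K.c00,
    J.c00 * K.c11 + J.c10 * K.c01 + J.c01 * K.c10 + J.c11 * K.c00,
    J.c00 * K.c02 + J.c01 * K.c01 + J.c02 * K.c00,
    J.c00 * K.c30 + J.c10 * K.c20 + J.c20 * K.c10 + J.c30 * K.c00,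
    J.c00 * K.c21 + J.c10 * K.c11 + J.c01 * K.c20 + J.c20 * K.c01 + J.c11 * K.c10 + J.c21 * K.c00,
    J.c00 * K.c12 + J.c10 * K.c02 + J.c01 * K.c11 + J.c02 * K.c10 + J.c11 * K.c01 + J.c12 * K.c00,
    J.c00 * K.c03 + J.c01 * K.c02 + J.c02 * K.c01 + J.c03 * K.c00⟩

theorem isBigO_monomial (l : Filter (ℝ × ℝ)) (i j : ℕ) :
    (fun w : ℝ × ℝ => w.1 ^ i * w.2 ^ j) =O[l] fun w => ‖w‖ ^ (i + j) := by
  refine IsBigO.of_norm_le fun w => ?_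
  rw [norm_mul, norm_pow, norm_pow, pow_add]
  gcongr
  · exact norm_fst_le w
  · exact norm_snd_le w

theorem isBigO_h1 (J : Jet) (l : Filter (ℝ × ℝ)) : J.h1 =O[l] fun w => ‖w‖ ^ 1 := by
  have a := (isBigO_monomial l 1 0).const_mul_left J.c10
  have b := (isBigO_monomial l 0 1).const_mul_left J.c01
  exact (a.add b).congr (fun w => by simp [h1]) fun w => by simp

theorem isBigO_h2 (J : Jet) (l : Filter (ℝ × ℝ)) : J.h2 =O[l] fun w => ‖w‖ ^ 2 := by
  have a := (isBigO_monomial l 2 0).const_mul_left J.c20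
  have b := (isBigO_monomial l 1 1).const_mul_left J.c11
  have c := (isBigO_monomial l 0 2).const_mul_left J.c02
  exact ((a.add b).add c).congr (fun w => by simp [h2]) fun w => by simp

theorem isBigO_h3 (J : Jet) (l : Filter (ℝ × ℝ)) : J.h3 =O[l] fun w => ‖w‖ ^ 3 := by
  have a := (isBigO_monomial l 3 0).const_mul_left J.c30
  have b := (isBigO_monomial l 2 1).const_mul_left J.c21
  have c := (isBigO_monomial l 1 2).const_mul_left J.c12
  have d := (isBigO_monomial l 0 3).const_mul_left J.c03
  exact (((a.add b).add c).add d).congr (fun w => by simp [h3]) fun w => by simp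

theorem continuous_eval (J : Jet) : Continuous J.eval := by
  unfold eval h1 h2 h3
  fun_prop

theorem h1_smul (J : Jet) (r : ℝ) (w : ℝ × ℝ) : J.h1 (r • w) = r ^ 1 * J.h1 w := by
  simp only [h1, Prod.smul_fst, Prod.smul_snd, smul_eq_mul]; ring

theorem h2_smul (J : Jet) (r : ℝ) (w : ℝ × ℝ) : J.h2 (r • w) = r ^ 2 * J.h2 w := by
  simp only [h2, Prod.smul_fst, Prod.smul_snd, smul_eq_mul]; ring

theorem h3_smul (J : Jet) (r : ℝ) (w : ℝ × ℝ) : J.h3 (r • w) = r ^ 3 * J.h3 w := by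
  simp only [h3, Prod.smul_fst, Prod.smul_snd, smul_eq_mul]; ring

theorem eval_add (J K : Jet) (w : ℝ × ℝ) : (J.add K).eval w = J.eval w + K.eval w := by
  simp only [eval, h1, h2, h3, add]; ring

theorem eval_mul (J K : Jet) (w : ℝ × ℝ) :
    J.eval w * K.eval w - (J.mul K).eval w = J.h1 w * K.h3 w + J.h2 w * K.h2 w + J.h3 w * K.h1 w +
      J.h2 w * K.h3 w + J.h3 w * K.h2 w + J.h3 w * K.h3 w := by
  simp only [eval, h1, h2, h3, mul]; ring

end Jet

theorem isBigO_norm_pow_of_le {m n : ℕ} (h : m ≤ n) :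
    (fun w : ℝ × ℝ => ‖w‖ ^ n) =O[𝓝 0] fun w => ‖w‖ ^ m := by
  refine IsBigO.of_bound 1 ?_
  filter_upwards [Metric.ball_mem_nhds (0 : ℝ × ℝ) one_pos] with w hw
  rw [norm_pow, norm_pow, norm_norm, one_mul]
  exact pow_le_pow_of_le_one (norm_nonneg w) (by simpa using (mem_ball_zero_iff.1 hw).le) h

/-- A homogeneous function of degree `k` that vanishes to higher order at the origin is zero. -/
theorem eq_zero_of_homogeneous {k : ℕ} {h : ℝ × ℝ → ℝ} (hh : ∀ r w, h (r • w) = r ^ k * h w)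
    (hO : h =O[𝓝 0] fun w => ‖w‖ ^ (k + 1)) (w : ℝ × ℝ) : h w = 0 := by
  obtain ⟨C, hC⟩ := hO.bound
  have ht : Tendsto (fun r : ℝ => r • w) (𝓝[>] 0) (𝓝 0) := by
    have : Continuous fun r : ℝ => r • w := by fun_prop
    simpa using this.continuousWithinAt (s := Set.Ioi 0) (x := 0) |>.tendsto
  have hev : ∀ᶠ r : ℝ in 𝓝[>] 0, ‖h w‖ ≤ C * (r * ‖w‖ ^ (k + 1)) := by
    filter_upwards [ht.eventually hC, self_mem_nhdsWithin] with r hr hr0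
    have hr0 : 0 < r := hr0
    rw [hh, norm_mul, norm_pow, norm_pow, norm_norm, norm_smul, Real.norm_of_nonneg hr0.le,
      mul_pow] at hr
    have : 0 < r ^ k := by positivity
    refine le_of_mul_le_mul_left (hr.trans_eq ?_) this
    ring
  have hlim : Tendsto (fun r : ℝ => C * (r * ‖w‖ ^ (k + 1))) (𝓝[>] 0) (𝓝 0) := by
    have : Continuous fun r : ℝ => C * (r * ‖w‖ ^ (k + 1)) := by fun_prop
    simpa using this.continuousWithinAt (s := Set.Ioi 0) (x := 0) |>.tendsto
  exact norm_le_zero_iff.1 (ge_of_tendsto hlim hev)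

/-- A polynomial of degree at most three that is `O(‖w‖ ^ 4)` at the origin is zero. -/
theorem Jet.eq_const_zero_of_isBigO {J : Jet} (h : J.eval =O[𝓝 0] fun w => ‖w‖ ^ 4) :
    J = Jet.const 0 := by
  have e0 : J.c00 = 0 := by
    obtain ⟨C, hC⟩ := h.bound
    simpa [eval, h1, h2, h3] using hC.self_of_nhds
  have e1 : ∀ w, J.h1 w = 0 := by
    refine eq_zero_of_homogeneous J.h1_smul ?_
    have := ((h.trans (isBigO_norm_pow_of_le (show 2 ≤ 4 by norm_num))).sub (J.isBigO_h2 _)).sub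
      ((J.isBigO_h3 _).trans (isBigO_norm_pow_of_le (show 2 ≤ 3 by norm_num)))
    refine this.congr_left fun w => ?_
    rw [eval, e0]; ring
  have e2 : ∀ w, J.h2 w = 0 := by
    refine eq_zero_of_homogeneous J.h2_smul ?_
    have := (h.trans (isBigO_norm_pow_of_le (show 3 ≤ 4 by norm_num))).sub (J.isBigO_h3 _)
    refine this.congr_left fun w => ?_
    rw [eval, e0, e1]; ring
  have e3 : ∀ w, J.h3 w = 0 := by
    refine eq_zero_of_homogeneous J.h3_smul (h.congr_left fun w => ?_)
    rw [eval, e0, e1, e2]; ring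
  have a1 := e1 (1, 0)
  have a2 := e1 (0, 1)
  have b1 := e2 (1, 0)
  have b2 := e2 (0, 1)
  have b3 := e2 (1, 1)
  have d1 := e3 (1, 0)
  have d2 := e3 (0, 1)
  have d3 := e3 (1, 1)
  have d4 := e3 (1, -1)
  simp only [h1, h2, h3] at a1 a2 b1 b2 b3 d1 d2 d3 d4
  ext <;> simp only [const] <;> linarith

/-- `HasJet φ J` says that `J` is the Taylor polynomial of order three of `φ` at the origin. -/
def HasJet (φ : ℝ × ℝ → ℝ) (J : Jet) : Prop :=
  (fun w => φ w - J.eval w) =O[𝓝 0] fun w => ‖w‖ ^ 4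

namespace HasJet

variable {φ ψ : ℝ × ℝ → ℝ} {J K : Jet}

theorem const (a : ℝ) : HasJet (fun _ => a) (Jet.const a) := by
  refine (isBigO_zero _ _).congr_left fun w => ?_
  simp [Jet.eval, Jet.h1, Jet.h2, Jet.h3, Jet.const]

theorem fst : HasJet (fun w => w.1) ⟨0, 1, 0, 0, 0, 0, 0, 0, 0, 0⟩ := by
  refine (isBigO_zero _ _).congr_left fun w => ?_
  simp [Jet.eval, Jet.h1, Jet.h2, Jet.h3]

theorem snd : HasJet (fun w => w.2) ⟨0, 0, 1, 0, 0, 0, 0, 0, 0, 0⟩ := by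
  refine (isBigO_zero _ _).congr_left fun w => ?_
  simp [Jet.eval, Jet.h1, Jet.h2, Jet.h3]

theorem add (hφ : HasJet φ J) (hψ : HasJet ψ K) : HasJet (fun w => φ w + ψ w) (J.add K) := by
  refine (IsBigO.add hφ hψ).congr_left fun w => ?_
  rw [Jet.eval_add]; ring

theorem isBigO_one (hφ : HasJet φ J) : φ =O[𝓝 0] fun _ => (1 : ℝ) := by
  have h1 : (fun w => φ w - J.eval w) =O[𝓝 0] fun _ => (1 : ℝ) := by
    simpa using IsBigO.trans hφ (isBigO_norm_pow_of_le (Nat.zero_le 4))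
  have h2 : J.eval =O[𝓝 0] fun _ => (1 : ℝ) := J.continuous_eval.continuousAt.isBigO_one ℝ
  exact (h1.add h2).congr_left fun w => by ring

theorem mul (hφ : HasJet φ J) (hψ : HasJet ψ K) : HasJet (fun w => φ w * ψ w) (J.mul K) := by
  have h2 : J.eval =O[𝓝 0] fun _ => (1 : ℝ) := J.continuous_eval.continuousAt.isBigO_one ℝ
  have a : (fun w => (φ w - J.eval w) * ψ w) =O[𝓝 0] fun w => ‖w‖ ^ 4 := by
    simpa using IsBigO.mul hφ hψ.isBigO_one
  have b : (fun w => J.eval w * (ψ w - K.eval w)) =O[𝓝 0] fun w => ‖w‖ ^ 4 := by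
    simpa using IsBigO.mul h2 hψ
  have c {m n : ℕ} {α β : ℝ × ℝ → ℝ} (hmn : 4 ≤ m + n) (hα : α =O[𝓝 0] fun w => ‖w‖ ^ m)
      (hβ : β =O[𝓝 0] fun w => ‖w‖ ^ n) : (fun w => α w * β w) =O[𝓝 0] fun w => ‖w‖ ^ 4 := by
    refine IsBigO.trans ?_ (isBigO_norm_pow_of_le hmn)
    simpa only [pow_add] using hα.mul hβ
  have d := (((((c (by norm_num) (J.isBigO_h1 _) (K.isBigO_h3 _)).add
    (c (by norm_num) (J.isBigO_h2 _) (K.isBigO_h2 _))).add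
    (c (by norm_num) (J.isBigO_h3 _) (K.isBigO_h1 _))).add
    (c (by norm_num) (J.isBigO_h2 _) (K.isBigO_h3 _))).add
    (c (by norm_num) (J.isBigO_h3 _) (K.isBigO_h2 _))).add
    (c (by norm_num) (J.isBigO_h3 _) (K.isBigO_h3 _))
  refine ((a.add b).add d).congr_left fun w => ?_
  rw [← Jet.eval_mul]; ring

theorem congr (hφ : HasJet φ J) (hf : ∀ w, ψ w = φ w) (hJ : J = K) : HasJet ψ K := by
  rw [funext hf]
  exact hJ ▸ hφ

/-- The Taylor polynomial decides whether a function vanishes to order three. -/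
theorem isBigO_iff (hφ : HasJet φ J) :
    (φ =O[𝓝 0] fun w => ‖w‖ ^ 4) ↔ J = Jet.const 0 := by
  constructor
  · intro h
    exact Jet.eq_const_zero_of_isBigO ((IsBigO.sub h hφ).congr_left fun w => by ring)
  · rintro rfl
    refine IsBigO.congr_left hφ fun w => ?_
    simp [Jet.eval, Jet.h1, Jet.h2, Jet.h3, Jet.const]

end HasJet

/-! ### Taylor expansions -/

section Taylor

variable {f : ℝ × ℝ → ℝ}

/-- The `x`-derivative of a polynomial. -/
def Jet.dU (J : Jet) : Jet := ⟨J.c10, 2 * J.c20, J.c11, 3 * J.c30, 2 * J.c21, J.c12, 0, 0, 0, 0⟩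

/-- The `y`-derivative of a polynomial. -/
def Jet.dV (J : Jet) : Jet := ⟨J.c01, J.c11, 2 * J.c02, J.c21, 2 * J.c12, 3 * J.c03, 0, 0, 0, 0⟩

theorem hasDerivAt_cubic (a₀ a₁ a₂ a₃ x : ℝ) :
    HasDerivAt (fun s : ℝ => a₀ + a₁ * s + a₂ * s ^ 2 + a₃ * s ^ 3)
      (a₁ + 2 * a₂ * x + 3 * a₃ * x ^ 2) x := by
  have h1 := (hasDerivAt_id' x).const_mul a₁
  have h2 := (hasDerivAt_pow 2 x).const_mul a₂
  have h3 := (hasDerivAt_pow 3 x).const_mul a₃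
  exact (((h1.const_add a₀).add h2).add h3).congr_deriv (by push_cast; ring)

theorem Jet.contDiff_eval (J : Jet) : ContDiff ℝ ∞ J.eval := by
  unfold Jet.eval Jet.h1 Jet.h2 Jet.h3
  fun_prop

theorem Jet.hasDerivAt_eval_fst (J : Jet) (w : ℝ × ℝ) :
    HasDerivAt (fun s => J.eval (s, w.2)) (J.dU.eval w) w.1 := by
  refine ((hasDerivAt_cubic (J.c00 + J.c01 * w.2 + J.c02 * w.2 ^ 2 + J.c03 * w.2 ^ 3)
    (J.c10 + J.c11 * w.2 + J.c12 * w.2 ^ 2) (J.c20 + J.c21 * w.2) J.c30 w.1).congr_of_eventuallyEq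
      (Eventually.of_forall fun s => ?_)).congr_deriv ?_ <;>
  · simp only [Jet.eval, Jet.h1, Jet.h2, Jet.h3, Jet.dU]
    ring

theorem Jet.hasDerivAt_eval_snd (J : Jet) (w : ℝ × ℝ) :
    HasDerivAt (fun t => J.eval (w.1, t)) (J.dV.eval w) w.2 := by
  refine ((hasDerivAt_cubic (J.c00 + J.c10 * w.1 + J.c20 * w.1 ^ 2 + J.c30 * w.1 ^ 3)
    (J.c01 + J.c11 * w.1 + J.c21 * w.1 ^ 2) (J.c02 + J.c12 * w.1) J.c03 w.2).congr_of_eventuallyEq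
      (Eventually.of_forall fun s => ?_)).congr_deriv ?_ <;>
  · simp only [Jet.eval, Jet.h1, Jet.h2, Jet.h3, Jet.dV]
    ring

theorem partialU_comp_add_sub_eval (hf : ContDiff ℝ ∞ f) (p : ℝ × ℝ) (J : Jet) :
    partialU (fun w => f (p + w) - J.eval w) = fun w => partialU f (p + w) - J.dU.eval w := by
  funext w
  have hg : ContDiff ℝ ∞ fun w => f (p + w) - J.eval w :=
    (hf.comp (contDiff_const.add contDiff_id)).sub J.contDiff_eval
  refine (hasDerivAt_partialU hg w).unique (HasDerivAt.sub ?_ (J.hasDerivAt_eval_fst w))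
  exact (hasDerivAt_partialU hf (p + w)).comp_const_add p.1 w.1

theorem partialV_comp_add_sub_eval (hf : ContDiff ℝ ∞ f) (p : ℝ × ℝ) (J : Jet) :
    partialV (fun w => f (p + w) - J.eval w) = fun w => partialV f (p + w) - J.dV.eval w := by
  funext w
  have hg : ContDiff ℝ ∞ fun w => f (p + w) - J.eval w :=
    (hf.comp (contDiff_const.add contDiff_id)).sub J.contDiff_eval
  refine (hasDerivAt_partialV hg w).unique (HasDerivAt.sub ?_ (J.hasDerivAt_eval_snd w))
  exact (hasDerivAt_partialV hf (p + w)).comp_const_add p.2 w.2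

theorem isBigO_taylor_succ {k : ℕ} (hf : ContDiff ℝ ∞ f) (p : ℝ × ℝ) {J : Jet} (h0 : J.c00 = f p)
    (hu : (fun w => partialU f (p + w) - J.dU.eval w) =O[𝓝 0] fun w => ‖w‖ ^ k)
    (hv : (fun w => partialV f (p + w) - J.dV.eval w) =O[𝓝 0] fun w => ‖w‖ ^ k) :
    (fun w => f (p + w) - J.eval w) =O[𝓝 0] fun w => ‖w‖ ^ (k + 1) := by
  refine isBigO_pow_succ_of_partial
    ((hf.comp (contDiff_const.add contDiff_id)).sub J.contDiff_eval) ?_ ?_ ?_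
  · simp [Jet.eval, Jet.h1, Jet.h2, Jet.h3, h0]
  · rwa [partialU_comp_add_sub_eval hf]
  · rwa [partialV_comp_add_sub_eval hf]

/-- The Taylor polynomial of order three of `f` at `p`. -/
noncomputable def taylorJet (f : ℝ × ℝ → ℝ) (p : ℝ × ℝ) : Jet :=
  ⟨f p, partialU f p, partialV f p, partialU (partialU f) p / 2, partialU (partialV f) p,
    partialV (partialV f) p / 2, partialU (partialU (partialU f)) p / 6,
    partialU (partialU (partialV f)) p / 2, partialU (partialV (partialV f)) p / 2,
    partialV (partialV (partialV f)) p / 6⟩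

theorem hasJet_taylorJet (hf : ContDiff ℝ ∞ f) (p : ℝ × ℝ) :
    HasJet (fun w => f (p + w)) (taylorJet f p) := by
  have t0 {f : ℝ × ℝ → ℝ} (hf : ContDiff ℝ ∞ f) :
      (fun w => f (p + w) - (Jet.const (f p)).eval w) =O[𝓝 0] fun w => ‖w‖ ^ 1 := by
    have hd : DifferentiableAt ℝ (fun w => f (p + w)) 0 :=
      (hf.comp (contDiff_const.add contDiff_id)).differentiable (by simp) 0
    refine hd.isBigO_sub.norm_right.congr (fun w => ?_) fun w => ?_
    · simp [Jet.eval, Jet.h1, Jet.h2, Jet.h3, Jet.const]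
    · simp
  have t1 {f : ℝ × ℝ → ℝ} (hf : ContDiff ℝ ∞ f) :
      (fun w => f (p + w) - Jet.eval ⟨f p, partialU f p, partialV f p, 0, 0, 0, 0, 0, 0, 0⟩ w)
        =O[𝓝 0] fun w => ‖w‖ ^ 2 := by
    refine isBigO_taylor_succ hf p rfl ?_ ?_
    · convert t0 (contDiff_partialU hf) using 4
      simp [Jet.dU, Jet.const]
    · convert t0 (contDiff_partialV hf) using 4
      simp [Jet.dV, Jet.const]
  have t2 {f : ℝ × ℝ → ℝ} (hf : ContDiff ℝ ∞ f) :
      (fun w => f (p + w) - Jet.eval ⟨f p, partialU f p, partialV f p, partialU (partialU f) p / 2,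
        partialU (partialV f) p, partialV (partialV f) p / 2, 0, 0, 0, 0⟩ w)
        =O[𝓝 0] fun w => ‖w‖ ^ 3 := by
    refine isBigO_taylor_succ hf p rfl ?_ ?_
    · convert t1 (contDiff_partialU hf) using 4
      simp [Jet.dU, partialU_partialV_comm hf]
      ring
    · convert t1 (contDiff_partialV hf) using 4
      simp [Jet.dV]
      ring
  refine isBigO_taylor_succ hf p rfl ?_ ?_
  · convert t2 (contDiff_partialU hf) using 4
    simp [Jet.dU, taylorJet, partialU_partialV_comm (contDiff_partialV hf),
      ← funext (partialU_partialV_comm hf)]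
    ring_nf
    simp
  · convert t2 (contDiff_partialV hf) using 4
    simp [Jet.dV, taylorJet]
    ring_nf
    simp

end Taylor

theorem hasJet_arctan_fst :
    HasJet (fun w => Real.arctan w.1) ⟨0, 1, 0, 0, 0, 0, -(1 / 3), 0, 0, 0⟩ := by
  set J : Jet := ⟨0, 1, 0, 0, 0, 0, -(1 / 3), 0, 0, 0⟩ with hJ
  have hg : ContDiff ℝ ∞ fun w : ℝ × ℝ => Real.arctan w.1 - J.eval w :=
    (Real.contDiff_arctan.comp contDiff_fst).sub J.contDiff_eval
  have hu (w : ℝ × ℝ) : partialU (fun w => Real.arctan w.1 - J.eval w) w =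
      w.1 ^ 4 * (1 + w.1 ^ 2)⁻¹ := by
    refine (hasDerivAt_partialU hg w).unique
      (((Real.hasDerivAt_arctan w.1).sub (J.hasDerivAt_eval_fst w)).congr_deriv ?_)
    have : 1 + w.1 ^ 2 ≠ 0 := by positivity
    simp only [hJ, Jet.dU, Jet.eval, Jet.h1, Jet.h2, Jet.h3]
    field_simp
    ring
  have hv (w : ℝ × ℝ) : partialV (fun w => Real.arctan w.1 - J.eval w) w = 0 := by
    refine (hasDerivAt_partialV hg w).unique
      (((hasDerivAt_const w.2 (Real.arctan w.1)).sub (J.hasDerivAt_eval_snd w)).congr_deriv ?_)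
    simp [hJ, Jet.dV, Jet.eval, Jet.h1, Jet.h2, Jet.h3]
  refine isBigO_pow_succ_of_partial hg ?_ ?_ ?_
  · simp [hJ, Jet.eval, Jet.h1, Jet.h2, Jet.h3]
  · rw [funext hu]
    refine IsBigO.trans ?_ (isBigO_norm_pow_of_le (show 3 ≤ 4 by norm_num))
    refine IsBigO.of_norm_le fun w => ?_
    rw [norm_mul, norm_pow, norm_inv, Real.norm_of_nonneg (by positivity : 0 ≤ 1 + w.1 ^ 2)]
    calc ‖w.1‖ ^ 4 * (1 + w.1 ^ 2)⁻¹ ≤ ‖w.1‖ ^ 4 * 1 := by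
          gcongr
          exact inv_le_one_of_one_le₀ (by nlinarith [sq_nonneg w.1])
      _ ≤ ‖w‖ ^ 4 := by
          rw [mul_one]
          gcongr
          exact norm_fst_le w
  · rw [funext hv]
    exact isBigO_zero _ _

theorem hasJet_arctan_snd :
    HasJet (fun w => Real.arctan w.2) ⟨0, 0, 1, 0, 0, 0, 0, 0, 0, -(1 / 3)⟩ := by
  have hs : Tendsto (Prod.swap : ℝ × ℝ → ℝ × ℝ) (𝓝 0) (𝓝 0) := continuous_swap.tendsto 0
  have h := IsBigO.comp_tendsto hasJet_arctan_fst hs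
  refine h.congr (fun w => ?_) fun w => ?_
  · simp [Jet.eval, Jet.h1, Jet.h2, Jet.h3]
  · simp [Prod.norm_def, max_comm]

/-- The chart of the torus around `p` in which `x = tan ((u - u₀) / 2)` and
`y = tan ((v - v₀) / 2)`. In it the hyperboloid is the graph `(1, y, x, x * y)`. -/
noncomputable def tanChart (p w : ℝ × ℝ) : ℝ × ℝ :=
  p + (2 * Real.arctan w.1, 2 * Real.arctan w.2)

/-- The Taylor polynomial of order three of `f` in the coordinates of `tanChart p`. -/
noncomputable def chartJet (f : ℝ × ℝ → ℝ) (p : ℝ × ℝ) : Jet :=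
  ⟨f p, 2 * partialU f p, 2 * partialV f p, 2 * partialU (partialU f) p,
    4 * partialU (partialV f) p, 2 * partialV (partialV f) p,
    4 / 3 * partialU (partialU (partialU f)) p - 2 / 3 * partialU f p,
    4 * partialU (partialU (partialV f)) p, 4 * partialU (partialV (partialV f)) p,
    4 / 3 * partialV (partialV (partialV f)) p - 2 / 3 * partialV f p⟩

theorem continuous_tanChart (p : ℝ × ℝ) : Continuous (tanChart p) := by
  have := Real.continuous_arctan
  unfold tanChart
  fun_prop

theorem norm_tanChart_sub_le (p w : ℝ × ℝ) : ‖tanChart p w - p‖ ≤ 2 * ‖w‖ := by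
  have h (x : ℝ) : ‖Real.arctan x‖ ≤ ‖x‖ := by
    have hd (y : ℝ) : ‖deriv Real.arctan y‖ ≤ 1 := by
      rw [Real.deriv_arctan, Real.norm_of_nonneg (by positivity), div_le_one (by positivity)]
      nlinarith [sq_nonneg y]
    simpa using Convex.norm_image_sub_le_of_norm_deriv_le (f := Real.arctan) (C := 1)
      (s := Set.univ) (fun y _ => Real.differentiable_arctan y) (fun y _ => hd y) convex_univ
      (Set.mem_univ 0) (Set.mem_univ x)
  simp only [tanChart, add_sub_cancel_left, Prod.norm_def]
  rw [norm_mul, norm_mul, Real.norm_two, ← mul_max_of_nonneg _ _ zero_le_two]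
  gcongr <;> exact h _

theorem hasJet_comp_tanChart {f : ℝ × ℝ → ℝ} (hf : ContDiff ℝ ∞ f) (p : ℝ × ℝ) :
    HasJet (fun w => f (tanChart p w)) (chartJet f p) := by
  set σ : ℝ × ℝ → ℝ × ℝ := fun w => (2 * Real.arctan w.1, 2 * Real.arctan w.2) with hσ
  have hσO : σ =O[𝓝 0] fun w => w := by
    refine IsBigO.of_bound 2 (Eventually.of_forall fun w => ?_)
    have h := norm_tanChart_sub_le p w
    rwa [tanChart, add_sub_cancel_left] at h
  have hσt : Tendsto σ (𝓝 0) (𝓝 0) := hσO.trans_tendsto tendsto_id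
  have h1 : (fun w => f (tanChart p w) - (taylorJet f p).eval (σ w)) =O[𝓝 0] fun w => ‖w‖ ^ 4 :=
    (IsBigO.comp_tendsto (hasJet_taylorJet hf p) hσt).trans (hσO.norm_norm.pow 4)
  have hs := (HasJet.const 2).mul hasJet_arctan_fst
  have ht := (HasJet.const 2).mul hasJet_arctan_snd
  have hc (a : ℝ) := HasJet.const a
  set T := taylorJet f p with hT
  have h2 := ((((((((((hc T.c00).add ((hc T.c10).mul hs)).add ((hc T.c01).mul ht)).add
    ((hc T.c20).mul (hs.mul hs))).add ((hc T.c11).mul (hs.mul ht))).add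
    ((hc T.c02).mul (ht.mul ht))).add ((hc T.c30).mul (hs.mul (hs.mul hs)))).add
    ((hc T.c21).mul (hs.mul (hs.mul ht)))).add ((hc T.c12).mul (hs.mul (ht.mul ht)))).add
    ((hc T.c03).mul (ht.mul (ht.mul ht))))
  have h3 : HasJet (fun w => T.eval (σ w)) (chartJet f p) := by
    refine h2.congr (fun w => ?_) ?_
    · simp only [Jet.eval, Jet.h1, Jet.h2, Jet.h3, hσ]
      ring
    · simp only [Jet.mul, Jet.add, Jet.const, chartJet, hT, taylorJet]
      ext <;> ring
  exact (IsBigO.add h1 h3).congr_left fun w => by ring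

/-! ### The algebraic condition for an approximating quadric -/

theorem exists_quadraticForm_iff_exists_matrix (P : ((Fin 4 → ℝ) → ℝ) → Prop) :
    (∃ Q : QuadraticForm ℝ (Fin 4 → ℝ),
      (QuadraticMap.associated (R := ℝ) Q).Nondegenerate ∧ P fun w => Q w) ↔
    ∃ M : Matrix (Fin 4) (Fin 4) ℝ, M.IsSymm ∧ M.det ≠ 0 ∧ P fun w => w ⬝ᵥ M.mulVec w := by
  constructor
  · rintro ⟨Q, hQ, hP⟩
    set B := QuadraticMap.associated (R := ℝ) Q with hB
    have hM := Matrix.toLinearMap₂'_toMatrix' (R := ℝ) B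
    set M := LinearMap.toMatrix₂' ℝ B with hMdef
    refine ⟨M, ?_, ?_, ?_⟩
    · ext i j
      rw [Matrix.transpose_apply, hMdef, LinearMap.toMatrix₂'_apply, LinearMap.toMatrix₂'_apply]
      exact QuadraticMap.associated_isSymm ℝ Q _ _
    · rw [← hM] at hQ
      exact LinearMap.nondegenerate_toLinearMap₂'_iff_det_ne_zero.1 hQ
    · convert hP using 2 with w
      rw [← Matrix.toLinearMap₂'_apply', hM]
      exact QuadraticMap.associated_eq_self_apply ℝ Q w
  · rintro ⟨M, hs, hdet, hP⟩
    set B : (Fin 4 → ℝ) →ₗ[ℝ] (Fin 4 → ℝ) →ₗ[ℝ] ℝ := Matrix.toLinearMap₂' ℝ M with hB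
    have hsymm (x y : Fin 4 → ℝ) : B y x = B x y := by
      rw [hB, Matrix.toLinearMap₂'_apply', Matrix.toLinearMap₂'_apply', Matrix.dotProduct_mulVec,
        ← Matrix.mulVec_transpose, hs.eq, dotProduct_comm]
    have hassoc : QuadraticMap.associated (R := ℝ) (LinearMap.BilinMap.toQuadraticMap B) = B :=
      QuadraticMap.associated_left_inverse ℝ fun x y => hsymm y x
    refine ⟨LinearMap.BilinMap.toQuadraticMap B, ?_, ?_⟩
    · rw [hassoc]
      exact LinearMap.nondegenerate_toLinearMap₂'_of_det_ne_zero' hdet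
    · convert hP using 2 with w
      rw [← Matrix.toLinearMap₂'_apply', LinearMap.BilinMap.toQuadraticMap_apply]

namespace Jet

variable (G : Jet)

/-- The determinant `1 - g₀²` of the change of coordinates. -/
def det : ℝ := 1 - G.c00 ^ 2

/-- Minus the coefficient of the third homogeneous coordinate in the equation of the tangent plane
at the origin of `(1 + g x y, y - g x, x - g y, x y + g)`. -/
def tanX : ℝ := G.c10 + G.c00 * G.c01

/-- Minus the coefficient of the second homogeneous coordinate in the equation of the tangent plane
at the origin of `(1 + g x y, y - g x, x - g y, x y + g)`. -/
def tanY : ℝ := G.c01 + G.c00 * G.c10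

/-- The coefficient of `x ^ 2` in the second fundamental form, the quadratic part of the last
coordinate of `Jet.adapted`. -/
def quadX : ℝ := G.det * G.c20 + G.c10 * G.tanY

/-- The coefficient of `x * y` in the second fundamental form. -/
def quadXY : ℝ := G.det ^ 2 + G.det * G.c11 + G.c10 * G.tanX + G.c01 * G.tanY

/-- The coefficient of `y ^ 2` in the second fundamental form. -/
def quadY : ℝ := G.det * G.c02 + G.c01 * G.tanX

/-- The coefficient of `x ^ 3` in the cubic form. When the surface is written as the graph of the
last coordinate of `Jet.adapted` over the two middle ones, its cubic part is this form, up to a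
constant factor and with the middle coordinates expressed through `x` and `y` to first order. -/
def cubic30 : ℝ :=
  G.det * (G.det * G.c30 + G.c20 * G.tanY) + G.c10 * (G.quadXY + 2 * G.quadX * G.c00)

/-- The coefficient of `x ^ 2 * y` in the cubic form. -/
def cubic21 : ℝ :=
  G.det * (-(G.det * G.c00 * G.c10) + G.det * G.c21 + G.c20 * G.tanX + G.c11 * G.tanY) +
    G.c10 * (2 * G.quadX + 2 * G.quadY + 2 * G.quadXY * G.c00) +
    G.c01 * (G.quadXY + 2 * G.quadX * G.c00)

/-- The coefficient of `x * y ^ 2` in the cubic form. -/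
def cubic12 : ℝ :=
  G.det * (-(G.det * G.c00 * G.c01) + G.det * G.c12 + G.c11 * G.tanX + G.c02 * G.tanY) +
    G.c01 * (2 * G.quadX + 2 * G.quadY + 2 * G.quadXY * G.c00) +
    G.c10 * (G.quadXY + 2 * G.quadY * G.c00)

/-- The coefficient of `y ^ 3` in the cubic form. -/
def cubic03 : ℝ :=
  G.det * (G.det * G.c03 + G.c02 * G.tanX) + G.c01 * (G.quadXY + 2 * G.quadY * G.c00)

/-- The determinant of the linear system by which the coefficients of `x ^ 2 * y` and `x * y ^ 2`
determine a linear factor complementary to the second fundamental form in the cubic form. -/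
def factorDet : ℝ := G.quadXY ^ 2 - G.quadX * G.quadY

/-- First obstruction to the divisibility of the cubic form by the second fundamental form. -/
def obstructionX : ℝ :=
  G.cubic30 * G.factorDet - G.quadX * (G.quadXY * G.cubic21 - G.quadX * G.cubic12)

/-- Second obstruction to the divisibility of the cubic form by the second fundamental form. -/
def obstructionY : ℝ :=
  G.cubic03 * G.factorDet - G.quadY * (G.quadXY * G.cubic12 - G.quadY * G.cubic21)

/-- The surface `(1 + g x y, y - g x, x - g y, x y + g)` in linear coordinates adapted to its
tangent plane at the origin: the last coordinate vanishes there to order two. Here `G` is the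
Taylor polynomial and `g` the value of the function at `w = (x, y)`. -/
def adapted (g : ℝ) (w : ℝ × ℝ) : Fin 4 → ℝ :=
  ![1 + g * (w.1 * w.2),
    G.det * w.2 - (g - G.c00) * (w.1 + G.c00 * w.2),
    G.det * w.1 - (g - G.c00) * (w.2 + G.c00 * w.1),
    G.det * ((G.det - G.c00 * (g - G.c00)) * (w.1 * w.2) +
      (g - G.c00 - G.c10 * w.1 - G.c01 * w.2)) +
      (g - G.c00) * (G.tanX * w.2 + G.tanY * w.1)]

variable {G} {g : ℝ × ℝ → ℝ}

theorem hasJet_adapted_zero (hg : HasJet g G) :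
    HasJet (fun w => G.adapted (g w) w 0) ⟨1, 0, 0, 0, G.c00, 0, 0, G.c10, G.c01, 0⟩ := by
  refine ((HasJet.const 1).add (hg.mul (HasJet.fst.mul HasJet.snd))).congr (fun w => rfl) ?_
  simp [Jet.mul, Jet.add, Jet.const]

theorem hasJet_adapted_one (hg : HasJet g G) :
    HasJet (fun w => G.adapted (g w) w 1) ⟨0, 0, G.det, -G.c10, -(G.c01 + G.c00 * G.c10),
      -(G.c00 * G.c01), -G.c20, -(G.c11 + G.c00 * G.c20), -(G.c02 + G.c00 * G.c11),
      -(G.c00 * G.c02)⟩ := by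
  have hγ := hg.add (HasJet.const (-G.c00))
  refine (((HasJet.const G.det).mul HasJet.snd).add ((HasJet.const (-1)).mul
    (hγ.mul (HasJet.fst.add ((HasJet.const G.c00).mul HasJet.snd))))).congr (fun w => ?_) ?_
  · simp only [adapted, Matrix.cons_val]
    ring
  · simp only [Jet.mul, Jet.add, Jet.const]
    ext <;> simp only <;> ring

theorem hasJet_adapted_two (hg : HasJet g G) :
    HasJet (fun w => G.adapted (g w) w 2) ⟨0, G.det, 0, -(G.c00 * G.c10),
      -(G.c10 + G.c00 * G.c01), -G.c01, -(G.c00 * G.c20), -(G.c20 + G.c00 * G.c11),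
      -(G.c11 + G.c00 * G.c02), -G.c02⟩ := by
  have hγ := hg.add (HasJet.const (-G.c00))
  refine (((HasJet.const G.det).mul HasJet.fst).add ((HasJet.const (-1)).mul
    (hγ.mul (HasJet.snd.add ((HasJet.const G.c00).mul HasJet.fst))))).congr (fun w => ?_) ?_
  · simp only [adapted, Matrix.cons_val]
    ring
  · simp only [Jet.mul, Jet.add, Jet.const]
    ext <;> simp only <;> ring

theorem hasJet_adapted_three (hg : HasJet g G) :
    HasJet (fun w => G.adapted (g w) w 3) ⟨0, 0, 0, G.quadX, G.quadXY, G.quadY,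
      G.det * G.c30 + G.c20 * G.tanY,
      -(G.det * G.c00 * G.c10) + G.det * G.c21 + G.c20 * G.tanX + G.c11 * G.tanY,
      -(G.det * G.c00 * G.c01) + G.det * G.c12 + G.c11 * G.tanX + G.c02 * G.tanY,
      G.det * G.c03 + G.c02 * G.tanX⟩ := by
  have hc (a : ℝ) := HasJet.const a
  have hγ := hg.add (hc (-G.c00))
  have hx := HasJet.fst
  have hy := HasJet.snd
  have h1 := ((hc G.det).add ((hc (-G.c00)).mul hγ)).mul (hx.mul hy)
  have h2 := (hγ.add ((hc (-G.c10)).mul hx)).add ((hc (-G.c01)).mul hy)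
  have h3 := hγ.mul (((hc G.tanX).mul hy).add ((hc G.tanY).mul hx))
  refine (((hc G.det).mul (h1.add h2)).add h3).congr (fun w => ?_) ?_
  · simp only [adapted, Matrix.cons_val]
    ring
  · simp only [Jet.mul, Jet.add, Jet.const, quadX, quadXY, quadY]
    ext <;> simp only <;> ring

theorem hasJet_quadratic_adapted (hg : HasJet g G) (M : Matrix (Fin 4) (Fin 4) ℝ) (hM : M.IsSymm) :
    HasJet (fun w => G.adapted (g w) w ⬝ᵥ M.mulVec (G.adapted (g w) w))
      ⟨M 0 0, 2 * M 0 2 * G.det, 2 * M 0 1 * G.det,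
        2 * M 0 1 * -G.c10 + 2 * M 0 2 * -(G.c00 * G.c10) + 2 * M 0 3 * G.quadX +
          M 2 2 * G.det ^ 2,
        2 * M 0 0 * G.c00 + 2 * M 0 1 * -(G.c01 + G.c00 * G.c10) +
          2 * M 0 2 * -(G.c10 + G.c00 * G.c01) + 2 * M 0 3 * G.quadXY + 2 * M 1 2 * G.det ^ 2,
        2 * M 0 1 * -(G.c00 * G.c01) + 2 * M 0 2 * -G.c01 + 2 * M 0 3 * G.quadY +
          M 1 1 * G.det ^ 2,
        2 * M 0 1 * -G.c20 + 2 * M 0 2 * -(G.c00 * G.c20) +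
          2 * M 0 3 * (G.det * G.c30 + G.c20 * G.tanY) + 2 * M 1 2 * -(G.c10 * G.det) +
          2 * M 2 2 * -(G.det * G.c00 * G.c10) + 2 * M 2 3 * G.det * G.quadX,
        2 * M 0 0 * G.c10 + 2 * M 0 1 * -(G.c11 + G.c00 * G.c20) +
          2 * M 0 2 * (G.c00 * G.det - (G.c20 + G.c00 * G.c11)) +
          2 * M 0 3 * (-(G.det * G.c00 * G.c10) + G.det * G.c21 + G.c20 * G.tanX +
            G.c11 * G.tanY) + 2 * M 1 1 * -(G.det * G.c10) +
          2 * M 1 2 * -(G.det * (2 * G.c00 * G.c10 + G.c01)) +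
          2 * M 2 2 * -(G.det * (G.c10 + G.c00 * G.c01)) + 2 * M 1 3 * G.det * G.quadX +
          2 * M 2 3 * G.det * G.quadXY,
        2 * M 0 0 * G.c01 + 2 * M 0 1 * (G.c00 * G.det - (G.c02 + G.c00 * G.c11)) +
          2 * M 0 2 * -(G.c11 + G.c00 * G.c02) +
          2 * M 0 3 * (-(G.det * G.c00 * G.c01) + G.det * G.c12 + G.c11 * G.tanX +
            G.c02 * G.tanY) + 2 * M 1 1 * -(G.det * (G.c01 + G.c00 * G.c10)) +
          2 * M 1 2 * -(G.det * (G.c10 + 2 * G.c00 * G.c01)) +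
          2 * M 2 2 * -(G.det * G.c01) + 2 * M 1 3 * G.det * G.quadXY +
          2 * M 2 3 * G.det * G.quadY,
        2 * M 0 1 * -(G.c00 * G.c02) + 2 * M 0 2 * -G.c02 +
          2 * M 0 3 * (G.det * G.c03 + G.c02 * G.tanX) + 2 * M 1 1 * -(G.det * G.c00 * G.c01) +
          2 * M 1 2 * -(G.det * G.c01) + 2 * M 1 3 * G.det * G.quadY⟩ := by
  have h0 := hasJet_adapted_zero hg
  have h1 := hasJet_adapted_one hg
  have h2 := hasJet_adapted_two hg
  have h3 := hasJet_adapted_three hg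
  have hc (a : ℝ) := HasJet.const a
  have key := ((((((((((hc (M 0 0)).mul (h0.mul h0)).add ((hc (2 * M 0 1)).mul (h0.mul h1))).add
    ((hc (2 * M 0 2)).mul (h0.mul h2))).add ((hc (2 * M 0 3)).mul (h0.mul h3))).add
    ((hc (M 1 1)).mul (h1.mul h1))).add ((hc (2 * M 1 2)).mul (h1.mul h2))).add
    ((hc (2 * M 1 3)).mul (h1.mul h3))).add ((hc (M 2 2)).mul (h2.mul h2))).add
    ((hc (2 * M 2 3)).mul (h2.mul h3))).add ((hc (M 3 3)).mul (h3.mul h3))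
  refine key.congr (fun w => ?_) ?_
  · have e1 := hM.apply 0 1
    have e2 := hM.apply 0 2
    have e3 := hM.apply 0 3
    have e4 := hM.apply 1 2
    have e5 := hM.apply 1 3
    have e6 := hM.apply 2 3
    simp only [Matrix.mulVec, dotProduct, Fin.sum_univ_four, e1, e2, e3, e4, e5, e6]
    ring
  · simp only [Jet.mul, Jet.add, Jet.const]
    ext <;> simp only <;> ring

/-- Some non-degenerate quadric approximates the surface up to order three if and only if the
cubic form is divisible by the second fundamental form. -/
theorem exists_matrix_isBigO_iff (hg : HasJet g G) (hdet : G.det ≠ 0) (hfac : G.factorDet ≠ 0)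
    (hdisc : 4 * (G.quadX * G.quadY) ≠ G.quadXY ^ 2) :
    (∃ M : Matrix (Fin 4) (Fin 4) ℝ, M.IsSymm ∧ M.det ≠ 0 ∧
      (fun w => G.adapted (g w) w ⬝ᵥ M.mulVec (G.adapted (g w) w)) =O[𝓝 0] fun w => ‖w‖ ^ 4) ↔
    G.obstructionX = 0 ∧ G.obstructionY = 0 := by
  constructor
  · rintro ⟨M, hs, hM, hO⟩
    have hJ := (hasJet_quadratic_adapted hg M hs).isBigO_iff.1 hO
    simp only [const, Jet.mk.injEq] at hJ
    obtain ⟨q00, q02, q01, e20, e11, e02, e30, e21, e12, e03⟩ := hJ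
    have q02 : M 0 2 = 0 := by simpa [hdet] using q02
    have q01 : M 0 1 = 0 := by simpa [hdet] using q01
    simp only [q00, q01, q02] at e20 e11 e02 e30 e21 e12 e03
    -- The second order equations express the quadratic part of `M` through `M 0 3`, and turn the
    -- third order ones into divisibility of `M 0 3` times the cubic form.
    have f30 : M 0 3 * G.cubic30 + G.det ^ 2 * M 2 3 * G.quadX = 0 := by
      unfold cubic30
      linear_combination (G.det * e30 + 2 * (G.c00 * G.c10) * e20 + G.c10 * e11) / 2
    have f21 : M 0 3 * G.cubic21 + G.det ^ 2 * (M 1 3 * G.quadX + M 2 3 * G.quadXY) = 0 := by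
      unfold cubic21
      linear_combination (G.det * e21 + 2 * (G.c10 + G.c00 * G.c01) * e20 +
        (2 * G.c00 * G.c10 + G.c01) * e11 + 2 * G.c10 * e02) / 2
    have f12 : M 0 3 * G.cubic12 + G.det ^ 2 * (M 1 3 * G.quadXY + M 2 3 * G.quadY) = 0 := by
      unfold cubic12
      linear_combination (G.det * e12 + 2 * G.c01 * e20 +
        (G.c10 + 2 * G.c00 * G.c01) * e11 + 2 * (G.c01 + G.c00 * G.c10) * e02) / 2
    have f03 : M 0 3 * G.cubic03 + G.det ^ 2 * M 1 3 * G.quadY = 0 := by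
      unfold cubic03
      linear_combination (G.det * e03 + G.c01 * e11 + 2 * (G.c00 * G.c01) * e02) / 2
    have q03 : M 0 3 ≠ 0 := by
      intro q03
      rw [q03] at f21 f12
      have hd : G.det ^ 2 * G.factorDet ≠ 0 := mul_ne_zero (pow_ne_zero 2 hdet) hfac
      have q23 : M 2 3 = 0 := by
        refine (mul_eq_zero.1 (?_ : G.det ^ 2 * G.factorDet * M 2 3 = 0)).resolve_left hd
        unfold factorDet
        linear_combination G.quadXY * f21 - G.quadX * f12
      refine hM (Matrix.det_eq_zero_of_row_eq_zero 0 fun j => ?_)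
      fin_cases j <;> assumption
    constructor
    · refine (mul_eq_zero.1 (?_ : M 0 3 * G.obstructionX = 0)).resolve_left q03
      unfold obstructionX factorDet
      linear_combination (G.quadXY ^ 2 - G.quadX * G.quadY) * f30 -
        G.quadX * (G.quadXY * f21 - G.quadX * f12)
    · refine (mul_eq_zero.1 (?_ : M 0 3 * G.obstructionY = 0)).resolve_left q03
      unfold obstructionY factorDet
      linear_combination (G.quadXY ^ 2 - G.quadX * G.quadY) * f03 -
        G.quadY * (G.quadXY * f12 - G.quadY * f21)
  · rintro ⟨hX, hY⟩
    set a := G.quadX with ha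
    set b := G.quadXY with hb
    set c := G.quadY with hc
    -- The linear factor is `q * x + r * y`, by Cramer's rule in the two middle coefficients.
    set q := (b * G.cubic21 - a * G.cubic12) / G.factorDet with hq
    set r := (b * G.cubic12 - c * G.cubic21) / G.factorDet with hr
    have f30 : G.cubic30 = a * q := by
      unfold obstructionX at hX
      rw [hq]
      field_simp
      linear_combination hX
    have f21 : G.cubic21 = b * q + a * r := by
      rw [hq, hr]
      field_simp
      unfold factorDet
      ring
    have f12 : G.cubic12 = c * q + b * r := by
      rw [hq, hr]
      field_simp
      unfold factorDet
      ring
    have f03 : G.cubic03 = c * r := by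
      unfold obstructionY at hY
      rw [hr]
      field_simp
      linear_combination hY
    set d := G.det with hd
    refine ⟨!![0, 0, 0, d ^ 2 / 2; 0, -c, -b / 2, -r / 2; 0, -b / 2, -a, -q / 2;
      d ^ 2 / 2, -r / 2, -q / 2, 0], ?_, ?_, ?_⟩
    · ext i j
      fin_cases i <;> fin_cases j <;> rfl
    · have : Matrix.det !![0, 0, 0, d ^ 2 / 2; 0, -c, -b / 2, -r / 2; 0, -b / 2, -a, -q / 2;
          d ^ 2 / 2, -r / 2, -q / 2, 0] = d ^ 4 * (b ^ 2 - 4 * (a * c)) / 16 := by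
        simp [Matrix.det_succ_row_zero, Fin.sum_univ_succ, Fin.succAbove]
        ring
      rw [this]
      have := sub_ne_zero.2 hdisc.symm
      positivity
    · refine (hasJet_quadratic_adapted hg _ ?_).isBigO_iff.2 ?_
      · ext i j
        fin_cases i <;> fin_cases j <;> rfl
      · unfold cubic30 at f30
        unfold cubic21 at f21
        unfold cubic12 at f12
        unfold cubic03 at f03
        simp only [← ha, ← hb, ← hc, ← hd] at f30 f21 f12 f03
        simp only [← ha, ← hb, ← hc, ← hd, const, Jet.mk.injEq, Matrix.of_apply, Matrix.cons_val]
        refine ⟨trivial, by ring, by ring, by ring, by ring, by ring, ?_, ?_, ?_, ?_⟩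
        · linear_combination d * f30
        · linear_combination d * f21
        · linear_combination d * f12
        · linear_combination d * f03

end Jet

/-! ### The perturbed surface and its inverse parametrization -/

theorem perturbedParam_eq (f : ℝ × ℝ → ℝ) (ε u v : ℝ) :
    perturbedParam f ε u v =
      ![Real.cos (u / 2) * Real.cos (v / 2) +
          ε / 4 * f (u, v) * (Real.sin (u / 2) * Real.sin (v / 2)),
        Real.cos (u / 2) * Real.sin (v / 2) -
          ε / 4 * f (u, v) * (Real.sin (u / 2) * Real.cos (v / 2)),
        Real.sin (u / 2) * Real.cos (v / 2) -
          ε / 4 * f (u, v) * (Real.cos (u / 2) * Real.sin (v / 2)),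
        Real.sin (u / 2) * Real.sin (v / 2) +
          ε / 4 * f (u, v) * (Real.cos (u / 2) * Real.cos (v / 2))] := by
  ext i
  fin_cases i <;>
  · simp only [perturbedParam, hyperboloidNormal_eq, hyperboloidParam, Pi.add_apply, Pi.smul_apply,
      smul_eq_mul, Fin.zero_eta, Fin.mk_one, Fin.reduceFinMk, Matrix.cons_val]
    ring

theorem perturbedParam_dotProduct (f : ℝ × ℝ → ℝ) (ε u v : ℝ) :
    perturbedParam f ε u v ⬝ᵥ hyperboloidParam u v = 1 := by
  have e1 := Real.sin_sq_add_cos_sq (u / 2)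
  have e2 := Real.sin_sq_add_cos_sq (v / 2)
  simp only [perturbedParam_eq, hyperboloidParam, dotProduct, Fin.sum_univ_four, Matrix.cons_val]
  linear_combination (Real.sin (v / 2) ^ 2 + Real.cos (v / 2) ^ 2) * e1 + e2

theorem contDiff_perturbedParam {f : ℝ × ℝ → ℝ} (hf : ContDiff ℝ ∞ f) (ε : ℝ) :
    ContDiff ℝ ∞ fun q : ℝ × ℝ => perturbedParam f ε q.1 q.2 := by
  simp only [perturbedParam_eq]
  rw [contDiff_pi]
  intro i
  fin_cases i <;>
  · simp only [Fin.zero_eta, Fin.mk_one, Fin.reduceFinMk, Matrix.cons_val]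
    fun_prop

/-- The point of the perturbed surface with parameters `p`. -/
noncomputable def surfacePoint (f : ℝ × ℝ → ℝ) (ε : ℝ) (p : ℝ × ℝ) : ℙ ℝ (Fin 4 → ℝ) :=
  Projectivization.mk ℝ (perturbedParam f ε p.1 p.2) (perturbedParam_ne_zero f ε p.1 p.2)

theorem surfacePoint_periodic (f : SmoothTorusFunction) (ε : ℝ) {p q : ℝ × ℝ}
    (h1 : (p.1 : Real.Angle) = q.1) (h2 : (p.2 : Real.Angle) = q.2) :
    surfacePoint f.toFun ε p = surfacePoint f.toFun ε q := by
  have hc (x : ℝ) : Real.cos ((x + 2 * Real.pi) / 2) = -Real.cos (x / 2) := by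
    rw [add_div, mul_div_cancel_left₀ _ two_ne_zero, Real.cos_add_pi]
  have hs (x : ℝ) : Real.sin ((x + 2 * Real.pi) / 2) = -Real.sin (x / 2) := by
    rw [add_div, mul_div_cancel_left₀ _ two_ne_zero, Real.sin_add_pi]
  have hu (v : ℝ) : Function.Periodic (fun u => surfacePoint f.toFun ε (u, v)) (2 * Real.pi) := by
    intro u
    refine (Projectivization.mk_eq_mk_iff' _ _ _ _ _).2 ⟨-1, ?_⟩
    ext i
    fin_cases i <;> simp [perturbedParam_eq, hc, hs, f.periodic_fst] <;> ring
  have hv (u : ℝ) : Function.Periodic (fun v => surfacePoint f.toFun ε (u, v)) (2 * Real.pi) := by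
    intro v
    refine (Projectivization.mk_eq_mk_iff' _ _ _ _ _).2 ⟨-1, ?_⟩
    ext i
    fin_cases i <;> simp [perturbedParam_eq, hc, hs, f.periodic_snd] <;> ring
  obtain ⟨m, hm⟩ := Real.Angle.angle_eq_iff_two_pi_dvd_sub.1 h1
  obtain ⟨n, hn⟩ := Real.Angle.angle_eq_iff_two_pi_dvd_sub.1 h2
  obtain ⟨u, v⟩ := p
  obtain ⟨u', v'⟩ := q
  obtain rfl : u = u' + m * (2 * Real.pi) := by simp only at hm; linarith
  obtain rfl : v = v' + n * (2 * Real.pi) := by simp only at hn; linarith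
  exact ((hu _).int_mul m u').trans ((hv _).int_mul n v')

/-- If `y` represents the point with parameters `(u, v)` of the perturbed surface, this complex
number is a positive multiple of `exp (i u)`: viewing `y` as a `2 × 2` matrix, it is the doubled
direction of the dominant left singular vector. -/
noncomputable def directionU (y : Fin 4 → ℝ) : ℂ :=
  Complex.ofRealCLM (y 0 ^ 2 + y 1 ^ 2 - y 2 ^ 2 - y 3 ^ 2) +
    Complex.ofRealCLM (2 * (y 0 * y 2 + y 1 * y 3)) * Complex.I

/-- The analogue of `directionU` for the second parameter and right singular vectors. -/
noncomputable def directionV (y : Fin 4 → ℝ) : ℂ :=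
  Complex.ofRealCLM (y 0 ^ 2 + y 2 ^ 2 - y 1 ^ 2 - y 3 ^ 2) +
    Complex.ofRealCLM (2 * (y 0 * y 1 + y 2 * y 3)) * Complex.I

theorem differentiable_directionU : Differentiable ℝ directionU := by
  unfold directionU
  fun_prop

theorem differentiable_directionV : Differentiable ℝ directionV := by
  unfold directionV
  fun_prop

theorem directionU_re (y : Fin 4 → ℝ) :
    (directionU y).re = y 0 ^ 2 + y 1 ^ 2 - y 2 ^ 2 - y 3 ^ 2 := by
  simp only [directionU, Complex.ofRealCLM_apply, Complex.add_re, Complex.re_ofReal_mul,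
    Complex.ofReal_re, Complex.I_re, mul_zero, add_zero]

theorem directionU_im (y : Fin 4 → ℝ) : (directionU y).im = 2 * (y 0 * y 2 + y 1 * y 3) := by
  simp only [directionU, Complex.ofRealCLM_apply, Complex.add_im, Complex.im_ofReal_mul,
    Complex.ofReal_im, Complex.I_im, mul_one, zero_add]

theorem directionV_re (y : Fin 4 → ℝ) :
    (directionV y).re = y 0 ^ 2 + y 2 ^ 2 - y 1 ^ 2 - y 3 ^ 2 := by
  simp only [directionV, Complex.ofRealCLM_apply, Complex.add_re, Complex.re_ofReal_mul,
    Complex.ofReal_re, Complex.I_re, mul_zero, add_zero]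

theorem directionV_im (y : Fin 4 → ℝ) : (directionV y).im = 2 * (y 0 * y 1 + y 2 * y 3) := by
  simp only [directionV, Complex.ofRealCLM_apply, Complex.add_im, Complex.im_ofReal_mul,
    Complex.ofReal_im, Complex.I_im, mul_one, zero_add]

theorem directionU_smul_perturbedParam (f : ℝ × ℝ → ℝ) (ε t u v : ℝ) :
    directionU (t • perturbedParam f ε u v) =
      ((t ^ 2 * (1 - (ε / 4 * f (u, v)) ^ 2) : ℝ) : ℂ) * Complex.exp (u * Complex.I) := by
  have e1 := Real.sin_sq_add_cos_sq (u / 2)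
  have e2 := Real.sin_sq_add_cos_sq (v / 2)
  have h1 : Real.cos u = Real.cos (u / 2) ^ 2 - Real.sin (u / 2) ^ 2 := by
    rw [← Real.cos_two_mul']; congr 1; ring
  have h2 : Real.sin u = 2 * Real.sin (u / 2) * Real.cos (u / 2) := by
    rw [← Real.sin_two_mul]; congr 1; ring
  set a := ε / 4 * f (u, v) with ha
  apply Complex.ext
  · rw [directionU_re, Complex.re_ofReal_mul, Complex.exp_ofReal_mul_I_re, h1]
    simp only [perturbedParam_eq, ← ha, Pi.smul_apply, smul_eq_mul, Matrix.cons_val]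
    linear_combination t ^ 2 * (1 - a ^ 2) * (Real.cos (u / 2) ^ 2 - Real.sin (u / 2) ^ 2) * e2
  · rw [directionU_im, Complex.im_ofReal_mul, Complex.exp_ofReal_mul_I_im, h2]
    simp only [perturbedParam_eq, ← ha, Pi.smul_apply, smul_eq_mul, Matrix.cons_val]
    linear_combination 2 * t ^ 2 * (1 - a ^ 2) * (Real.cos (u / 2) * Real.sin (u / 2)) * e2

theorem directionV_smul_perturbedParam (f : ℝ × ℝ → ℝ) (ε t u v : ℝ) :
    directionV (t • perturbedParam f ε u v) =
      ((t ^ 2 * (1 - (ε / 4 * f (u, v)) ^ 2) : ℝ) : ℂ) * Complex.exp (v * Complex.I) := by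
  have e1 := Real.sin_sq_add_cos_sq (u / 2)
  have h1 : Real.cos v = Real.cos (v / 2) ^ 2 - Real.sin (v / 2) ^ 2 := by
    rw [← Real.cos_two_mul']; congr 1; ring
  have h2 : Real.sin v = 2 * Real.sin (v / 2) * Real.cos (v / 2) := by
    rw [← Real.sin_two_mul]; congr 1; ring
  set a := ε / 4 * f (u, v) with ha
  apply Complex.ext
  · rw [directionV_re, Complex.re_ofReal_mul, Complex.exp_ofReal_mul_I_re, h1]
    simp only [perturbedParam_eq, ← ha, Pi.smul_apply, smul_eq_mul, Matrix.cons_val]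
    linear_combination t ^ 2 * (1 - a ^ 2) * (Real.cos (v / 2) ^ 2 - Real.sin (v / 2) ^ 2) * e1
  · rw [directionV_im, Complex.im_ofReal_mul, Complex.exp_ofReal_mul_I_im, h2]
    simp only [perturbedParam_eq, ← ha, Pi.smul_apply, smul_eq_mul, Matrix.cons_val]
    linear_combination 2 * t ^ 2 * (1 - a ^ 2) * (Real.cos (v / 2) * Real.sin (v / 2)) * e1

theorem coe_arg_div_eq {r r' a b : ℝ} (hr : 0 < r) (hr' : 0 < r') :
    ((Complex.arg ((r : ℂ) * Complex.exp (a * Complex.I) /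
      (r' * Complex.exp (b * Complex.I))) : ℝ) : Real.Angle) = ((a - b : ℝ) : Real.Angle) := by
  have : (r : ℂ) * Complex.exp (a * Complex.I) / (r' * Complex.exp (b * Complex.I)) =
      ((r / r' : ℝ) : ℂ) *
        (Real.Angle.cos (a - b : ℝ) + Real.Angle.sin (a - b : ℝ) * Complex.I) := by
    rw [Real.Angle.cos_coe, Real.Angle.sin_coe, Complex.ofReal_cos, Complex.ofReal_sin,
      ← Complex.exp_mul_I, mul_div_mul_comm, ← Complex.exp_sub]
    push_cast
    ring_nf
  rw [this, Complex.arg_mul_cos_add_sin_mul_I_coe_angle (div_pos hr hr')]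

section Local

variable {f : SmoothTorusFunction} {ε : ℝ}

theorem scale_pos (h : ∀ p, |ε / 4 * f.toFun p| < 1) {t : ℝ} (ht : t ≠ 0) (p : ℝ × ℝ) :
    0 < t ^ 2 * (1 - (ε / 4 * f.toFun p) ^ 2) := by
  have := (sq_lt_one_iff_abs_lt_one _).2 (h p)
  have := sub_pos.2 this
  positivity

/-- The parametrization of the torus is injective as long as `|ε f / 4| < 1`. -/
theorem surfacePoint_injective (h : ∀ p, |ε / 4 * f.toFun p| < 1) {p q : ℝ × ℝ}
    (hpq : surfacePoint f.toFun ε p = surfacePoint f.toFun ε q) :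
    (p.1 : Real.Angle) = q.1 ∧ (p.2 : Real.Angle) = q.2 := by
  obtain ⟨a, ha⟩ := (Projectivization.mk_eq_mk_iff' _ _ _ _ _).1 hpq
  have ha0 : a ≠ 0 := by
    rintro rfl
    rw [zero_smul] at ha
    exact perturbedParam_ne_zero _ _ _ _ ha.symm
  have h1 := directionU_smul_perturbedParam f.toFun ε 1 p.1 p.2
  have h2 := directionV_smul_perturbedParam f.toFun ε 1 p.1 p.2
  rw [one_smul, ← ha, directionU_smul_perturbedParam] at h1
  rw [one_smul, ← ha, directionV_smul_perturbedParam] at h2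
  have hp := scale_pos h one_ne_zero p
  have hq := scale_pos h ha0 q
  have key {x y r s : ℝ} (hr : 0 < r) (hs : 0 < s)
      (hxy : (s : ℂ) * Complex.exp (y * Complex.I) = r * Complex.exp (x * Complex.I)) :
      (x : Real.Angle) = y := by
    have := coe_arg_div_eq (a := y) (b := x) hs hr
    rw [hxy, div_self (by simp [hr.ne', Complex.exp_ne_zero]), Complex.arg_one] at this
    have h0 : ((y - x : ℝ) : Real.Angle) = 0 := by simpa using this.symm
    rw [Real.Angle.coe_sub, sub_eq_zero] at h0
    exact h0.symm
  exact ⟨key hp hq h1, key hp hq h2⟩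

/-- The parameters of a point of the surface near `p`, as a function of homogeneous coordinates
near the representative `y₀` of the point with parameters `p`. -/
noncomputable def localParam (p : ℝ × ℝ) (y₀ y : Fin 4 → ℝ) : ℝ × ℝ :=
  (p.1 + (Complex.log (directionU y / directionU y₀)).im,
    p.2 + (Complex.log (directionV y / directionV y₀)).im)

/-- The inverse parametrization is Lipschitz at `y₀`. -/
theorem isBigO_localParam_sub (h : ∀ p, |ε / 4 * f.toFun p| < 1) {t : ℝ} (ht : t ≠ 0)
    (p : ℝ × ℝ) {y₀ : Fin 4 → ℝ} (hy₀ : y₀ = t • perturbedParam f.toFun ε p.1 p.2) :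
    (fun y => localParam p y₀ y - p) =O[𝓝 y₀] fun y => y - y₀ := by
  have hne : directionU y₀ ≠ 0 ∧ directionV y₀ ≠ 0 := by
    rw [hy₀, directionU_smul_perturbedParam, directionV_smul_perturbedParam]
    have := (scale_pos h ht p).ne'
    constructor <;> exact mul_ne_zero (by exact_mod_cast this) (Complex.exp_ne_zero _)
  have key {D : (Fin 4 → ℝ) → ℂ} (hD : Differentiable ℝ D) (h0 : D y₀ ≠ 0) :
      DifferentiableAt ℝ (fun y => (Complex.log (D y / D y₀)).im) y₀ := by
    have h1 : DifferentiableAt ℝ Complex.log (D y₀ / D y₀) := by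
      rw [div_self h0]
      exact (Complex.differentiableAt_log (by simp)).restrictScalars ℝ
    have h2 : DifferentiableAt ℝ (fun y => D y / D y₀) y₀ := by
      simp only [div_eq_mul_inv]
      exact (hD y₀).mul_const _
    exact Complex.imCLM.differentiableAt.comp y₀ (h1.comp y₀ h2)
  have hd : DifferentiableAt ℝ (localParam p y₀) y₀ :=
    ((key differentiable_directionU hne.1).const_add _).prodMk
      ((key differentiable_directionV hne.2).const_add _)
  have h0 : localParam p y₀ y₀ = p := by
    simp [localParam, div_self hne.1, div_self hne.2]
  simpa only [h0] using hd.isBigO_sub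

/-- On the cone over the surface, `localParam` is indeed inverse to the parametrization. -/
theorem exists_smul_eq_of_mem_puncturedCone (h : ∀ p, |ε / 4 * f.toFun p| < 1) {t : ℝ}
    (ht : t ≠ 0) (p : ℝ × ℝ) {y y₀ : Fin 4 → ℝ}
    (hy₀ : y₀ = t • perturbedParam f.toFun ε p.1 p.2)
    (hy : y ∈ puncturedCone (perturbedSurface f.toFun ε)) :
    ∃ a : ℝ, y = a • perturbedParam f.toFun ε (localParam p y₀ y).1 (localParam p y₀ y).2 := by
  obtain ⟨hy0, q, hq⟩ := hy
  obtain ⟨b, hb⟩ := (Projectivization.mk_eq_mk_iff' _ _ _ _ _).1 hq.symm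
  have hb0 : b ≠ 0 := by
    rintro rfl
    rw [zero_smul] at hb
    exact hy0 hb.symm
  have e : surfacePoint f.toFun ε q = surfacePoint f.toFun ε (localParam p y₀ y) := by
    refine (surfacePoint_periodic f ε ?_ ?_).symm
    · simp only [localParam, Complex.log_im, Real.Angle.coe_add]
      rw [← hb, hy₀, directionU_smul_perturbedParam, directionU_smul_perturbedParam,
        coe_arg_div_eq (scale_pos h hb0 q) (scale_pos h ht p), Real.Angle.coe_sub]
      abel
    · simp only [localParam, Complex.log_im, Real.Angle.coe_add]
      rw [← hb, hy₀, directionV_smul_perturbedParam, directionV_smul_perturbedParam,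
        coe_arg_div_eq (scale_pos h hb0 q) (scale_pos h ht p), Real.Angle.coe_sub]
      abel
  obtain ⟨a, ha⟩ := (Projectivization.mk_eq_mk_iff' _ _ _ _ _).1 e
  exact ⟨b * a, by rw [mul_smul, ha, hb]⟩

theorem norm_hyperboloidParam_le (u v : ℝ) : ‖hyperboloidParam u v‖ ≤ 1 := by
  refine (pi_norm_le_iff_of_nonneg zero_le_one).2 fun i => ?_
  have key {a b : ℝ} (ha : |a| ≤ 1) (hb : |b| ≤ 1) : ‖a * b‖ ≤ 1 := by
    rw [Real.norm_eq_abs, abs_mul]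
    exact mul_le_one₀ ha (abs_nonneg b) hb
  have hc := Real.abs_cos_le_one
  have hs := Real.abs_sin_le_one
  fin_cases i
  · exact key (hc _) (hc _)
  · exact key (hc _) (hs _)
  · exact key (hs _) (hc _)
  · exact key (hs _) (hs _)

/-- The order of contact of a quadric with the surface may be read off in the parameters. -/
theorem isBigO_puncturedCone_iff (h : ∀ p, |ε / 4 * f.toFun p| < 1) (p : ℝ × ℝ)
    (Q : QuadraticForm ℝ (Fin 4 → ℝ)) :
    ((fun y => Q y) =O[𝓝[puncturedCone (perturbedSurface f.toFun ε)] (surfacePoint f.toFun ε p).rep]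
      fun y => ‖y - (surfacePoint f.toFun ε p).rep‖ ^ 4) ↔
    (fun q : ℝ × ℝ => Q (perturbedParam f.toFun ε q.1 q.2)) =O[𝓝 p] fun q => ‖q - p‖ ^ 4 := by
  obtain ⟨t, ht⟩ := Projectivization.exists_smul_eq_mk_rep ℝ (perturbedParam f.toFun ε p.1 p.2)
    (perturbedParam_ne_zero _ _ _ _)
  have ht0 : (t : ℝ) ≠ 0 := t.ne_zero
  set y₀ := (surfacePoint f.toFun ε p).rep with hy₀
  replace ht : y₀ = (t : ℝ) • perturbedParam f.toFun ε p.1 p.2 := ht.symm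
  have hsm := contDiff_perturbedParam f.smooth ε
  constructor
  · intro hO
    have hmaps : Tendsto (fun q : ℝ × ℝ => (t : ℝ) • perturbedParam f.toFun ε q.1 q.2) (𝓝 p)
        (𝓝[puncturedCone (perturbedSurface f.toFun ε)] y₀) := by
      refine tendsto_nhdsWithin_iff.2 ⟨?_, Eventually.of_forall fun q => ?_⟩
      · rw [ht]
        exact (hsm.continuous.const_smul (t : ℝ)).tendsto p
      · have hne := smul_ne_zero ht0 (perturbedParam_ne_zero f.toFun ε q.1 q.2)
        exact ⟨hne, q, (Projectivization.mk_eq_mk_iff' _ _ _ _ _).2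
          ⟨(t : ℝ)⁻¹, inv_smul_smul₀ ht0 _⟩⟩
    have hlip : (fun q : ℝ × ℝ => (t : ℝ) • perturbedParam f.toFun ε q.1 q.2 - y₀) =O[𝓝 p]
        fun q => q - p := by
      rw [ht]
      exact ((hsm.differentiable (by simp) p).const_smul (t : ℝ)).isBigO_sub
    have h1 := (hO.comp_tendsto hmaps).trans (hlip.norm_norm.pow 4)
    refine (h1.const_mul_left ((t : ℝ) ^ 2)⁻¹).congr_left fun q => ?_
    simp only [Function.comp_apply, QuadraticMap.map_smul, smul_eq_mul]
    field_simp
  · intro hO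
    have hlip := isBigO_localParam_sub h ht0 p ht
    have hlim : Tendsto (localParam p y₀) (𝓝 y₀) (𝓝 p) := by
      have : Tendsto (fun y => y - y₀) (𝓝 y₀) (𝓝 0) := by
        simpa using (continuous_id.sub continuous_const).tendsto (f := fun y => y - y₀) y₀
      simpa using (hlip.trans_tendsto this).add_const p
    have h1 := (hO.comp_tendsto hlim).trans (hlip.norm_norm.pow 4)
    have h2 : (fun y : Fin 4 → ℝ => 16 * ‖y‖ ^ 2) =O[𝓝 y₀] fun _ => (1 : ℝ) :=
      (by fun_prop : Continuous fun y : Fin 4 → ℝ => 16 * ‖y‖ ^ 2).continuousAt.isBigO_one ℝ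
    have h3 := ((h2.mul h1).mono (nhdsWithin_le_nhds
      (s := puncturedCone (perturbedSurface f.toFun ε)))).congr_right fun y => one_mul _
    refine IsBigO.trans (IsBigO.of_bound 1 ?_) h3
    filter_upwards [self_mem_nhdsWithin] with y hy
    obtain ⟨a, ha⟩ := exists_smul_eq_of_mem_puncturedCone h ht0 p ht hy
    set q := localParam p y₀ y with hq
    -- The scalar `a` is bounded near `y₀`, since the parametrization has scalar product `1` with
    -- that of the hyperboloid.
    have hdot : a = y ⬝ᵥ hyperboloidParam q.1 q.2 := by
      conv_rhs => rw [ha]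
      rw [smul_dotProduct, perturbedParam_dotProduct, smul_eq_mul, mul_one]
    have hbound : |a| ≤ 4 * ‖y‖ := by
      rw [hdot, dotProduct]
      refine (Finset.abs_sum_le_sum_abs _ _).trans ?_
      have : ∀ i ∈ Finset.univ, |y i * hyperboloidParam q.1 q.2 i| ≤ ‖y‖ := fun i _ => by
        rw [abs_mul]
        exact (mul_le_mul (norm_le_pi_norm y i)
          ((norm_le_pi_norm _ i).trans (norm_hyperboloidParam_le _ _)) (abs_nonneg _)
          (norm_nonneg _)).trans_eq (mul_one _)
      simpa using Finset.sum_le_card_nsmul _ _ _ this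
    have ha2 : a ^ 2 ≤ 16 * ‖y‖ ^ 2 := by
      rw [← sq_abs]
      nlinarith [abs_nonneg a, norm_nonneg y]
    rw [one_mul, Function.comp_apply]
    conv_lhs => rw [ha]
    rw [QuadraticMap.map_smul, smul_eq_mul, norm_mul, Real.norm_of_nonneg (mul_self_nonneg a),
      norm_mul (16 * ‖y‖ ^ 2), Real.norm_of_nonneg (by positivity : 0 ≤ 16 * ‖y‖ ^ 2), ← sq]
    gcongr

end Local

/-! ### Quadratic points in terms of the obstructions -/

theorem isBigO_comp_tanChart_iff (φ : ℝ × ℝ → ℝ) (p : ℝ × ℝ) :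
    (φ =O[𝓝 p] fun q => ‖q - p‖ ^ 4) ↔
      (fun w => φ (tanChart p w)) =O[𝓝 0] fun w : ℝ × ℝ => ‖w‖ ^ 4 := by
  have h0 : tanChart p 0 = p := by simp [tanChart]
  constructor
  · intro h
    have ht : Tendsto (tanChart p) (𝓝 0) (𝓝 p) := by
      simpa only [h0] using (continuous_tanChart p).tendsto 0
    have hO : (fun w => tanChart p w - p) =O[𝓝 0] fun w : ℝ × ℝ => w :=
      IsBigO.of_bound 2 (Eventually.of_forall fun w => norm_tanChart_sub_le p w)
    exact (h.comp_tendsto ht).trans (hO.norm_norm.pow 4)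
  · intro h
    set τ : ℝ × ℝ → ℝ × ℝ :=
      fun q => (Real.tan ((q.1 - p.1) / 2), Real.tan ((q.2 - p.2) / 2)) with hτ
    have hτ0 : τ p = 0 := by simp [hτ]
    have hd1 : DifferentiableAt ℝ (fun q : ℝ × ℝ => Real.tan ((q.1 - p.1) / 2)) p := by
      have h1 : DifferentiableAt ℝ Real.tan ((p.1 - p.1) / 2) :=
        Real.differentiableAt_tan.2 (by simp)
      exact DifferentiableAt.comp (g := Real.tan) (f := fun q : ℝ × ℝ => (q.1 - p.1) / 2) p h1
        (by fun_prop)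
    have hd2 : DifferentiableAt ℝ (fun q : ℝ × ℝ => Real.tan ((q.2 - p.2) / 2)) p := by
      have h1 : DifferentiableAt ℝ Real.tan ((p.2 - p.2) / 2) :=
        Real.differentiableAt_tan.2 (by simp)
      exact DifferentiableAt.comp (g := Real.tan) (f := fun q : ℝ × ℝ => (q.2 - p.2) / 2) p h1
        (by fun_prop)
    have hd : DifferentiableAt ℝ τ p := hd1.prodMk hd2
    have ht : Tendsto τ (𝓝 p) (𝓝 0) := by simpa only [hτ0] using hd.continuousAt.tendsto
    have hO : τ =O[𝓝 p] fun q => q - p := by simpa only [hτ0, sub_zero] using hd.isBigO_sub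
    refine ((h.comp_tendsto ht).trans (hO.norm_norm.pow 4)).congr' ?_ EventuallyEq.rfl
    filter_upwards [Metric.ball_mem_nhds p Real.pi_pos] with q hq
    rw [Metric.mem_ball, Prod.dist_eq, max_lt_iff, Real.dist_eq, Real.dist_eq, abs_lt, abs_lt] at hq
    have key : tanChart p (τ q) = q := by
      ext
      · simp only [tanChart, hτ, Prod.fst_add]
        rw [Real.arctan_tan (by linarith) (by linarith)]
        ring
      · simp only [tanChart, hτ, Prod.snd_add]
        rw [Real.arctan_tan (by linarith) (by linarith)]
        ring
    simp only [Function.comp_apply, key]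

theorem exists_matrix_of_mulVec {α : Type*} {A X : α → Fin 4 → ℝ} {K : Matrix (Fin 4) (Fin 4) ℝ}
    (hK : K.det ≠ 0) (hA : ∀ w, A w = K.mulVec (X w)) (P : (α → ℝ) → Prop)
    (h : ∃ M : Matrix (Fin 4) (Fin 4) ℝ, M.IsSymm ∧ M.det ≠ 0 ∧
      P fun w => A w ⬝ᵥ M.mulVec (A w)) :
    ∃ M : Matrix (Fin 4) (Fin 4) ℝ, M.IsSymm ∧ M.det ≠ 0 ∧ P fun w => X w ⬝ᵥ M.mulVec (X w) := by
  obtain ⟨M, hs, hdet, hP⟩ := h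
  refine ⟨K.transpose * M * K, ?_, ?_, ?_⟩
  · rw [Matrix.IsSymm, Matrix.transpose_mul, Matrix.transpose_mul, Matrix.transpose_transpose,
      hs.eq, Matrix.mul_assoc]
  · rw [Matrix.det_mul, Matrix.det_mul, Matrix.det_transpose]
    exact mul_ne_zero (mul_ne_zero hK hdet) hK
  · convert hP using 2 with w
    rw [hA, ← Matrix.mulVec_mulVec, ← Matrix.mulVec_mulVec, Matrix.mulVec_transpose,
      dotProduct_comm, ← Matrix.dotProduct_mulVec, dotProduct_comm]

theorem exists_matrix_iff_of_mulVec {α : Type*} {A X : α → Fin 4 → ℝ}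
    {K : Matrix (Fin 4) (Fin 4) ℝ} (hK : K.det ≠ 0) (hA : ∀ w, A w = K.mulVec (X w))
    (P : (α → ℝ) → Prop) :
    (∃ M : Matrix (Fin 4) (Fin 4) ℝ, M.IsSymm ∧ M.det ≠ 0 ∧ P fun w => A w ⬝ᵥ M.mulVec (A w)) ↔
    ∃ M : Matrix (Fin 4) (Fin 4) ℝ, M.IsSymm ∧ M.det ≠ 0 ∧ P fun w => X w ⬝ᵥ M.mulVec (X w) := by
  refine ⟨exists_matrix_of_mulVec hK hA P, exists_matrix_of_mulVec (K := K⁻¹) ?_ (fun w => ?_) P⟩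
  · rw [Matrix.det_nonsing_inv]
    simpa using hK
  · rw [hA, Matrix.mulVec_mulVec, Matrix.nonsing_inv_mul K (Ne.isUnit hK), Matrix.one_mulVec]

/-- The orthogonal change of homogeneous coordinates that moves the point with parameters `p` of
the hyperboloid to the one with parameters `0`. -/
noncomputable def rotation (p : ℝ × ℝ) : Matrix (Fin 4) (Fin 4) ℝ :=
  let c := Real.cos (p.1 / 2)
  let s := Real.sin (p.1 / 2)
  let C := Real.cos (p.2 / 2)
  let S := Real.sin (p.2 / 2)
  !![c * C, c * S, s * C, s * S; -(c * S), c * C, -(s * S), s * C;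
    -(s * C), -(s * S), c * C, c * S; s * S, -(s * C), -(c * S), c * C]

theorem rotation_mul_transpose (p : ℝ × ℝ) : rotation p * (rotation p).transpose = 1 := by
  have e1 := Real.sin_sq_add_cos_sq (p.1 / 2)
  have e2 := Real.sin_sq_add_cos_sq (p.2 / 2)
  ext i j
  fin_cases i <;> fin_cases j <;>
    simp [rotation, Matrix.mul_apply, Fin.sum_univ_four] <;>
    first
      | ring1
      | linear_combination (Real.sin (p.2 / 2) ^ 2 + Real.cos (p.2 / 2) ^ 2) * e1 + e2

theorem rotation_mulVec_perturbedParam (f : ℝ × ℝ → ℝ) (ε : ℝ) (p w : ℝ × ℝ) :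
    (rotation p).mulVec (perturbedParam f ε (tanChart p w).1 (tanChart p w).2) =
      (Real.cos (Real.arctan w.1) * Real.cos (Real.arctan w.2)) •
        ![1 + ε / 4 * f (tanChart p w) * (w.1 * w.2), w.2 - ε / 4 * f (tanChart p w) * w.1,
          w.1 - ε / 4 * f (tanChart p w) * w.2, w.1 * w.2 + ε / 4 * f (tanChart p w)] := by
  have hsin (x : ℝ) : Real.sin (Real.arctan x) = x * Real.cos (Real.arctan x) := by
    rw [Real.sin_arctan, Real.cos_arctan]; ring
  have h1 : (tanChart p w).1 / 2 = p.1 / 2 + Real.arctan w.1 := by simp [tanChart]; ring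
  have h2 : (tanChart p w).2 / 2 = p.2 / 2 + Real.arctan w.2 := by simp [tanChart]; ring
  have key : perturbedParam f ε (tanChart p w).1 (tanChart p w).2 =
      (rotation p).transpose.mulVec ((Real.cos (Real.arctan w.1) * Real.cos (Real.arctan w.2)) •
        ![1 + ε / 4 * f (tanChart p w) * (w.1 * w.2), w.2 - ε / 4 * f (tanChart p w) * w.1,
          w.1 - ε / 4 * f (tanChart p w) * w.2, w.1 * w.2 + ε / 4 * f (tanChart p w)]) := by
    rw [perturbedParam_eq, h1, h2, Real.cos_add, Real.cos_add, Real.sin_add, Real.sin_add, hsin,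
      hsin, Prod.mk.eta]
    ext i
    fin_cases i <;> simp [rotation, Matrix.mulVec, dotProduct, Fin.sum_univ_four] <;> ring
  rw [key, Matrix.mulVec_mulVec, rotation_mul_transpose, Matrix.one_mulVec]

namespace Jet

variable (G : Jet)

/-- The linear change of coordinates from `(1 + g x y, y - g x, x - g y, x y + g)` to
`Jet.adapted`. -/
def adaptedMatrix : Matrix (Fin 4) (Fin 4) ℝ :=
  !![1, 0, 0, 0; 0, 1, G.c00, 0; 0, G.c00, 1, 0; -(G.det * G.c00), -G.tanY, -G.tanX, G.det]

theorem det_adaptedMatrix : G.adaptedMatrix.det = G.det ^ 2 := by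
  simp [adaptedMatrix, Matrix.det_succ_row_zero, Fin.sum_univ_succ, Fin.succAbove, det]
  ring

theorem adapted_eq_mulVec (g : ℝ) (w : ℝ × ℝ) :
    G.adapted g w = G.adaptedMatrix.mulVec
      ![1 + g * (w.1 * w.2), w.2 - g * w.1, w.1 - g * w.2, w.1 * w.2 + g] := by
  ext i
  fin_cases i <;>
    simp [adapted, adaptedMatrix, Matrix.mulVec, dotProduct, Fin.sum_univ_four, det, tanX, tanY] <;>
    ring

end Jet

/-- The Taylor polynomial of `ε f / 4` in the coordinates of `tanChart p`. -/
noncomputable def scaledJet (f : ℝ × ℝ → ℝ) (ε : ℝ) (p : ℝ × ℝ) : Jet :=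
  (Jet.const (ε / 4)).mul (chartJet f p)

/-- A point of the perturbed surface is quadratic if and only if both obstructions vanish. -/
theorem isQuadraticPoint_iff {f : SmoothTorusFunction} {ε : ℝ}
    (h : ∀ p, |ε / 4 * f.toFun p| < 1) (p : ℝ × ℝ)
    (hfac : (scaledJet f.toFun ε p).factorDet ≠ 0)
    (hdisc : 4 * ((scaledJet f.toFun ε p).quadX * (scaledJet f.toFun ε p).quadY) ≠
      (scaledJet f.toFun ε p).quadXY ^ 2) :
    IsQuadraticPoint (perturbedSurface f.toFun ε) (surfacePoint f.toFun ε p) ↔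
      (scaledJet f.toFun ε p).obstructionX = 0 ∧ (scaledJet f.toFun ε p).obstructionY = 0 := by
  set G := scaledJet f.toFun ε p with hG
  set X : ℝ × ℝ → Fin 4 → ℝ := fun w =>
    perturbedParam f.toFun ε (tanChart p w).1 (tanChart p w).2 with hX
  set g : ℝ × ℝ → ℝ := fun w => ε / 4 * f.toFun (tanChart p w) with hg
  set l : ℝ × ℝ → ℝ := fun w => Real.cos (Real.arctan w.1) * Real.cos (Real.arctan w.2) with hl
  have hjet : HasJet g G := (HasJet.const (ε / 4)).mul (hasJet_comp_tanChart f.smooth p)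
  have hdet : G.det ≠ 0 := by
    have h0 : G.c00 = ε / 4 * f.toFun p := rfl
    have := sub_pos.2 ((sq_lt_one_iff_abs_lt_one _).2 (h p))
    rw [Jet.det, h0]
    exact this.ne'
  have hK : (G.adaptedMatrix * rotation p).det ≠ 0 := by
    rw [Matrix.det_mul, Jet.det_adaptedMatrix]
    have hr := congrArg Matrix.det (rotation_mul_transpose p)
    rw [Matrix.det_mul, Matrix.det_one] at hr
    exact mul_ne_zero (pow_ne_zero 2 hdet) (left_ne_zero_of_mul_eq_one hr)
  have hA (w : ℝ × ℝ) : l w • G.adapted (g w) w = (G.adaptedMatrix * rotation p).mulVec (X w) := by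
    rw [← Matrix.mulVec_mulVec, hX]
    simp only
    rw [rotation_mulVec_perturbedParam, Matrix.mulVec_smul, Jet.adapted_eq_mulVec]
  have hl2 (w : ℝ × ℝ) : (1 + w.1 ^ 2) * (1 + w.2 ^ 2) * (l w * l w) = 1 := by
    have h1 := Real.cos_sq_arctan w.1
    have h2 := Real.cos_sq_arctan w.2
    have : l w * l w = Real.cos (Real.arctan w.1) ^ 2 * Real.cos (Real.arctan w.2) ^ 2 := by
      rw [hl]; ring
    rw [this, h1, h2]
    have : 1 + w.1 ^ 2 ≠ 0 := by positivity
    have : 1 + w.2 ^ 2 ≠ 0 := by positivity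
    field_simp
  have hO1 : (fun w : ℝ × ℝ => (1 + w.1 ^ 2) * (1 + w.2 ^ 2)) =O[𝓝 0] fun _ => (1 : ℝ) :=
    Continuous.continuousAt (by fun_prop) |>.isBigO_one ℝ
  have hO2 : (fun w : ℝ × ℝ => l w * l w) =O[𝓝 0] fun _ => (1 : ℝ) := by
    refine Continuous.continuousAt ?_ |>.isBigO_one ℝ
    have := Real.continuous_arctan
    simp only [hl]
    fun_prop
  have hmem : surfacePoint f.toFun ε p ∈ perturbedSurface f.toFun ε := ⟨p, rfl⟩
  have e1 := exists_quadraticForm_iff_exists_matrix fun φ =>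
    (fun w => φ (X w)) =O[𝓝 0] fun w : ℝ × ℝ => ‖w‖ ^ 4
  have e2 := exists_matrix_iff_of_mulVec hK hA fun φ => φ =O[𝓝 0] fun w : ℝ × ℝ => ‖w‖ ^ 4
  rw [← G.exists_matrix_isBigO_iff hjet hdet hfac hdisc]
  simp only [IsQuadraticPoint, hmem, true_and, isBigO_puncturedCone_iff h]
  have e3 (Q : QuadraticForm ℝ (Fin 4 → ℝ)) := isBigO_comp_tanChart_iff
    (fun q => Q (perturbedParam f.toFun ε q.1 q.2)) p
  simp only [e3]
  rw [e1, ← e2]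
  -- The factor `l` is bounded above and below near the origin.
  refine exists_congr fun M => and_congr_right fun _ => and_congr_right fun _ => ?_
  simp only [Matrix.mulVec_smul, smul_dotProduct, dotProduct_smul, smul_eq_mul, ← mul_assoc]
  constructor
  · intro hO
    refine ((hO1.mul hO).congr_left fun w => ?_).congr_right fun w => one_mul _
    rw [← mul_assoc, hl2, one_mul]
  · intro hO
    exact (hO2.mul hO).congr_right fun w => one_mul _

/-! ### Counting the zeros of a perturbed system -/

/-- If near each point of the fibre over `0` a closed family `Z` of subsets of a compact space has
exactly one point for each small parameter, then the number of points is finite and constant for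
small parameters. -/
theorem finite_and_eventually_encard_eq {K : Type*} [TopologicalSpace K] [CompactSpace K]
    [T2Space K] {Z : Set (ℝ × K)} (hZ : IsClosed Z)
    (hex : ∀ z, (0, z) ∈ Z → ∀ N ∈ 𝓝 z, ∀ᶠ ε in 𝓝 (0 : ℝ), ∃ k ∈ N, (ε, k) ∈ Z)
    (huniq : ∀ z, (0, z) ∈ Z → ∃ U ∈ 𝓝 z, ∀ᶠ ε in 𝓝 (0 : ℝ),
      ∀ k ∈ U, ∀ k' ∈ U, (ε, k) ∈ Z → (ε, k') ∈ Z → k = k') :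
    {k | ((0 : ℝ), k) ∈ Z}.Finite ∧
      ∀ᶠ ε in 𝓝 (0 : ℝ), {k | (ε, k) ∈ Z}.encard = {k | ((0 : ℝ), k) ∈ Z}.encard := by
  classical
  set Z₀ : Set K := {k | ((0 : ℝ), k) ∈ Z} with hZ₀
  choose! U hU hUev using huniq
  have hfin : Z₀.Finite := by
    have hcl : IsCompact Z₀ :=
      (hZ.preimage (by fun_prop : Continuous fun k : K => ((0 : ℝ), k))).isCompact
    obtain ⟨t, ht, hcov⟩ := hcl.elim_nhds_subcover U hU
    have h1 : ∀ x ∈ t, (Z₀ ∩ U x).Finite := fun x hx =>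
      Set.Subsingleton.finite fun k hk k' hk' =>
        (hUev x (ht x hx)).self_of_nhds k hk.2 k' hk'.2 hk.1 hk'.1
    refine (t.finite_toSet.biUnion h1).subset fun k hk => ?_
    obtain ⟨x, hx, hxk⟩ := Set.mem_iUnion₂.1 (hcov hk)
    exact Set.mem_biUnion hx ⟨hk, hxk⟩
  refine ⟨hfin, ?_⟩
  obtain ⟨V, hV, hdisj⟩ := hfin.t2_separation
  set W : K → Set K := fun z => V z ∩ interior (U z) with hW
  have hWo (z : K) : IsOpen (W z) := (hV z).2.inter isOpen_interior
  have hWmem : ∀ z ∈ Z₀, z ∈ W z := fun z hz => ⟨(hV z).1, mem_interior_iff_mem_nhds.2 (hU z hz)⟩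
  have h1 : ∀ᶠ ε in 𝓝 (0 : ℝ), ∀ z ∈ Z₀, ∃ k ∈ W z, (ε, k) ∈ Z :=
    (eventually_all_finite hfin).2 fun z hz => hex z hz _ ((hWo z).mem_nhds (hWmem z hz))
  have h2 : ∀ᶠ ε in 𝓝 (0 : ℝ), ∀ z ∈ Z₀, ∀ k ∈ U z, ∀ k' ∈ U z,
      (ε, k) ∈ Z → (ε, k') ∈ Z → k = k' := (eventually_all_finite hfin).2 hUev
  have h3 : ∀ᶠ ε in 𝓝 (0 : ℝ), ∀ k ∈ (Set.univ : Set K), (ε, k) ∈ Z → ∃ z ∈ Z₀, k ∈ W z := by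
    refine isCompact_univ.eventually_forall_of_forall_eventually fun k _ => ?_
    by_cases hk : ((0 : ℝ), k) ∈ Z
    · have : ∀ᶠ x : ℝ × K in 𝓝 (0, k), x.2 ∈ W k :=
        continuous_snd.continuousAt.eventually_mem ((hWo k).mem_nhds (hWmem k hk))
      exact this.mono fun x hx _ => ⟨k, hk, hx⟩
    · exact (hZ.isOpen_compl.mem_nhds hk : _ ∈ 𝓝 _) |> fun h => mem_of_superset h
        fun x hx hx' => (hx hx').elim
  filter_upwards [h1, h2, h3] with ε h1 h2 h3
  choose! ψ hψW hψZ using h1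
  have hinj : Set.InjOn ψ Z₀ := by
    intro z hz z' hz' hzz
    by_contra hne
    exact Set.disjoint_left.1 (hdisj hz hz' hne) (hψW z hz).1 (hzz ▸ (hψW z' hz').1)
  rw [← hinj.encard_image]
  congr 1
  ext k
  constructor
  · intro hk
    obtain ⟨z, hz, hkz⟩ := h3 k trivial hk
    exact ⟨z, hz, h2 z hz _ (interior_subset (hψW z hz).2) _ (interior_subset hkz.2) (hψZ z hz) hk⟩
  · rintro ⟨z, hz, rfl⟩
    exact hψZ z hz

/-- A non-degenerate zero persists and stays locally unique. -/
theorem eventually_existsUnique_zero {H : ℝ × (ℝ × ℝ) → ℝ × ℝ} (hH : ContDiff ℝ ∞ H) {z : ℝ × ℝ}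
    (hz : H (0, z) = 0) (hinj : ∀ w, fderiv ℝ (fun p => H (0, p)) z w = 0 → w = 0) :
    (∀ N ∈ 𝓝 z, ∀ᶠ ε in 𝓝 (0 : ℝ), ∃ k ∈ N, H (ε, k) = 0) ∧
      ∃ U ∈ 𝓝 z, ∀ᶠ ε in 𝓝 (0 : ℝ),
        ∀ k ∈ U, ∀ k' ∈ U, H (ε, k) = 0 → H (ε, k') = 0 → k = k' := by
  -- Apply the inverse function theorem to `(ε, p) ↦ (ε, H (ε, p))`.
  set Ψ : ℝ × (ℝ × ℝ) → ℝ × (ℝ × ℝ) := fun x => (x.1, H x) with hΨ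
  set L := (ContinuousLinearMap.fst ℝ ℝ (ℝ × ℝ)).prod (fderiv ℝ H (0, z)) with hL
  have hstrict : HasStrictFDerivAt Ψ L (0, z) :=
    hasStrictFDerivAt_fst.prodMk (hH.contDiffAt.hasStrictFDerivAt (by simp))
  have hpart (w : ℝ × ℝ) : fderiv ℝ (fun p => H (0, p)) z w = fderiv ℝ H (0, z) (0, w) := by
    have h1 : HasFDerivAt H (fderiv ℝ H (0, z)) (0, z) :=
      (hH.differentiable (by simp) _).hasFDerivAt
    have h2 : HasFDerivAt (fun p => H (0, p)) _ z := h1.comp z (hasFDerivAt_prodMk_right (0 : ℝ) z)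
    rw [h2.fderiv]
    simp
  have hker : LinearMap.ker (L : ℝ × (ℝ × ℝ) →ₗ[ℝ] ℝ × (ℝ × ℝ)) = ⊥ := by
    refine LinearMap.ker_eq_bot'.2 fun x hx => ?_
    have h1 : x.1 = 0 := congrArg Prod.fst hx
    have h2 : fderiv ℝ H (0, z) x = 0 := congrArg Prod.snd hx
    have h3 : x = (0, x.2) := by rw [← h1]
    rw [h3, ← hpart] at h2
    rw [h3, hinj _ h2]
    rfl
  have hrange : LinearMap.range (L : ℝ × (ℝ × ℝ) →ₗ[ℝ] ℝ × (ℝ × ℝ)) = ⊤ :=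
    LinearMap.ker_eq_bot_iff_range_eq_top.1 hker
  set e := ContinuousLinearEquiv.ofBijective L hker hrange with he
  have hs : HasStrictFDerivAt Ψ (e : ℝ × (ℝ × ℝ) →L[ℝ] ℝ × (ℝ × ℝ)) (0, z) := by
    rw [he, ContinuousLinearEquiv.coe_ofBijective]
    exact hstrict
  set Φ := hs.toOpenPartialHomeomorph Ψ with hΦ
  have hΦc : (Φ : ℝ × (ℝ × ℝ) → ℝ × (ℝ × ℝ)) = Ψ := hs.toOpenPartialHomeomorph_coe
  have hsrc : ((0 : ℝ), z) ∈ Φ.source := hs.mem_toOpenPartialHomeomorph_source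
  have hΨ0 : Ψ (0, z) = (0, 0) := by rw [hΨ]; simp only [hz]
  constructor
  · intro N hN
    have ht : Tendsto (fun ε : ℝ => Φ.symm (ε, 0)) (𝓝 0) (𝓝 (0, z)) := by
      have h1 : ContinuousAt Φ.symm (0, 0) := by
        have := Φ.continuousAt_symm (Φ.map_source hsrc)
        rwa [hΦc, hΨ0] at this
      have h2 : Φ.symm ((0 : ℝ), (0 : ℝ × ℝ)) = (0, z) := by
        rw [← hΨ0, ← hΦc, Φ.left_inv hsrc]
      rw [ContinuousAt, h2] at h1
      exact h1.comp ((by fun_prop : Continuous fun ε : ℝ => (ε, (0 : ℝ × ℝ))).tendsto 0)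
    have htgt : ∀ᶠ ε : ℝ in 𝓝 0, (ε, (0 : ℝ × ℝ)) ∈ Φ.target := by
      refine ((by fun_prop : Continuous fun ε : ℝ => (ε, (0 : ℝ × ℝ))).tendsto 0).eventually
        (Φ.open_target.mem_nhds ?_)
      rw [← hΨ0, ← hΦc]
      exact Φ.map_source hsrc
    have hN' : ∀ᶠ x : ℝ × (ℝ × ℝ) in 𝓝 (0, z), x.2 ∈ N :=
      continuous_snd.continuousAt.eventually_mem hN
    filter_upwards [ht.eventually hN', htgt] with ε h1 h2
    have h3 : Ψ (Φ.symm (ε, 0)) = (ε, 0) := by rw [← hΦc, Φ.right_inv h2]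
    refine ⟨_, h1, ?_⟩
    have h4 : (Φ.symm (ε, 0)).1 = ε := congrArg Prod.fst h3
    have h5 : H (Φ.symm (ε, 0)) = 0 := congrArg Prod.snd h3
    convert h5
    exact h4.symm
  · obtain ⟨I, U, hI, h0I, hU, hzU, hIU⟩ :=
      mem_nhds_prod_iff'.1 (Φ.open_source.mem_nhds hsrc)
    refine ⟨U, hU.mem_nhds hzU, ?_⟩
    filter_upwards [hI.mem_nhds h0I] with ε hε k hk k' hk' h h'
    have : Ψ (ε, k) = Ψ (ε, k') := by rw [hΨ]; simp only [h, h']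
    rw [← hΦc] at this
    exact congrArg Prod.snd (Φ.injOn (hIU ⟨hε, hk⟩) (hIU ⟨hε, hk'⟩) this)

/-! ### Functions on the torus -/

/-- Functions of `(u, v)` that are `2π`-periodic in both variables. -/
def IsTorusPeriodic {α : Type*} (φ : ℝ × ℝ → α) : Prop :=
  ∀ p q : ℝ × ℝ, (p.1 : Real.Angle) = q.1 → (p.2 : Real.Angle) = q.2 → φ p = φ q

/-- The fundamental domain `[0, 2π) × [0, 2π)` of the torus. -/
def fundamentalBox : Set (ℝ × ℝ) :=
  Set.Ico 0 (2 * Real.pi) ×ˢ Set.Ico 0 (2 * Real.pi)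

theorem exists_mem_fundamentalBox (p : ℝ × ℝ) :
    ∃ q ∈ fundamentalBox, (p.1 : Real.Angle) = q.1 ∧ (p.2 : Real.Angle) = q.2 := by
  refine ⟨(toIcoMod Real.two_pi_pos 0 p.1, toIcoMod Real.two_pi_pos 0 p.2), ⟨?_, ?_⟩, ?_, ?_⟩
  · simpa using toIcoMod_mem_Ico Real.two_pi_pos 0 p.1
  · simpa using toIcoMod_mem_Ico Real.two_pi_pos 0 p.2
  · exact (Real.Angle.coe_toIcoMod _ _).symm
  · exact (Real.Angle.coe_toIcoMod _ _).symm

theorem eq_of_mem_fundamentalBox {p q : ℝ × ℝ} (hp : p ∈ fundamentalBox) (hq : q ∈ fundamentalBox)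
    (h1 : (p.1 : Real.Angle) = q.1) (h2 : (p.2 : Real.Angle) = q.2) : p = q := by
  have key {x y : ℝ} (hx : x ∈ Set.Ico 0 (2 * Real.pi)) (hy : y ∈ Set.Ico 0 (2 * Real.pi))
      (h : (x : Real.Angle) = y) : x = y := by
    have e (z : ℝ) (hz : z ∈ Set.Ico 0 (2 * Real.pi)) : toIcoMod Real.two_pi_pos 0 z = z :=
      (toIcoMod_eq_self Real.two_pi_pos).2 (by simpa using hz)
    obtain ⟨n, hn⟩ := Real.Angle.angle_eq_iff_two_pi_dvd_sub.1 h
    rw [← e x hx, ← e y hy, show x = y + n • (2 * Real.pi) by rw [zsmul_eq_mul]; linarith,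
      toIcoMod_add_zsmul]
  exact Prod.ext (key hp.1 hq.1 h1) (key hp.2 hq.2 h2)

theorem isTorusPeriodic_toFun (f : SmoothTorusFunction) : IsTorusPeriodic f.toFun := by
  have hu (v : ℝ) : Function.Periodic (fun u => f.toFun (u, v)) (2 * Real.pi) :=
    fun u => f.periodic_fst u v
  have hv (u : ℝ) : Function.Periodic (fun v => f.toFun (u, v)) (2 * Real.pi) :=
    fun v => f.periodic_snd u v
  rintro ⟨u, v⟩ ⟨u', v'⟩ h1 h2
  obtain ⟨m, hm⟩ := Real.Angle.angle_eq_iff_two_pi_dvd_sub.1 h1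
  obtain ⟨n, hn⟩ := Real.Angle.angle_eq_iff_two_pi_dvd_sub.1 h2
  obtain rfl : u = u' + m * (2 * Real.pi) := by simp only at hm; linarith
  obtain rfl : v = v' + n * (2 * Real.pi) := by simp only at hn; linarith
  exact ((hu _).int_mul m u').trans ((hv _).int_mul n v')

theorem IsTorusPeriodic.fderiv {E : Type*} [NormedAddCommGroup E] [NormedSpace ℝ E]
    {φ : ℝ × ℝ → E} (h : IsTorusPeriodic φ) : IsTorusPeriodic (fderiv ℝ φ) := by
  intro p q h1 h2
  have h3 : (fun x => φ (x + (q - p))) = φ := by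
    funext x
    refine h _ _ ?_ ?_ <;> simp [Real.Angle.coe_add, Real.Angle.coe_sub, h1, h2]
  rw [← add_sub_cancel p q, ← fderiv_comp_add_right (f := φ) (q - p), h3]

theorem IsTorusPeriodic.partialU {φ : ℝ × ℝ → ℝ} (h : IsTorusPeriodic φ) :
    IsTorusPeriodic (partialU φ) := fun p q h1 h2 => by
  unfold HyperboloidPerturbation.partialU
  rw [h.fderiv p q h1 h2]

theorem IsTorusPeriodic.partialV {φ : ℝ × ℝ → ℝ} (h : IsTorusPeriodic φ) :
    IsTorusPeriodic (partialV φ) := fun p q h1 h2 => by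
  unfold HyperboloidPerturbation.partialV
  rw [h.fderiv p q h1 h2]

theorem IsTorusPeriodic.exists_norm_le {E : Type*} [NormedAddCommGroup E] {φ : ℝ × ℝ → E}
    (h : IsTorusPeriodic φ) (hc : Continuous φ) : ∃ C, ∀ p, ‖φ p‖ ≤ C := by
  have hK : IsCompact (Set.Icc (0 : ℝ) (2 * Real.pi) ×ˢ Set.Icc (0 : ℝ) (2 * Real.pi)) :=
    isCompact_Icc.prod isCompact_Icc
  obtain ⟨C, hC⟩ := hK.exists_bound_of_continuousOn hc.continuousOn
  refine ⟨C, fun p => ?_⟩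
  obtain ⟨q, hq, h1, h2⟩ := exists_mem_fundamentalBox p
  rw [h p q h1 h2]
  exact hC q ⟨Set.Ico_subset_Icc_self hq.1, Set.Ico_subset_Icc_self hq.2⟩

/-- A periodic system all of whose zeros for the parameter `0` are non-degenerate has finitely many
zeros on the torus, and their number does not change for small parameters. -/
theorem finite_and_eventually_encard_zeros_eq {H : ℝ × (ℝ × ℝ) → ℝ × ℝ} (hH : ContDiff ℝ ∞ H)
    (hper : ∀ ε, IsTorusPeriodic fun p => H (ε, p))
    (hinj : ∀ z, H (0, z) = 0 → ∀ w, fderiv ℝ (fun p => H (0, p)) z w = 0 → w = 0) :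
    {p | p ∈ fundamentalBox ∧ H (0, p) = 0}.Finite ∧ ∀ᶠ ε in 𝓝 (0 : ℝ),
      {p | p ∈ fundamentalBox ∧ H (ε, p) = 0}.encard =
        {p | p ∈ fundamentalBox ∧ H (0, p) = 0}.encard := by
  have : Fact (0 < 2 * Real.pi) := ⟨Real.two_pi_pos⟩
  have : CompactSpace Real.Angle := inferInstanceAs (CompactSpace (AddCircle (2 * Real.pi)))
  have hcoe : IsOpenQuotientMap (fun x : ℝ => (x : Real.Angle)) :=
    QuotientAddGroup.isOpenQuotientMap_mk
  set π : ℝ × ℝ → Real.Angle × Real.Angle :=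
    Prod.map (fun x => (x : Real.Angle)) (fun x => (x : Real.Angle)) with hπ
  have hπq : IsOpenQuotientMap π := hcoe.prodMap hcoe
  have hπq' : IsOpenQuotientMap (Prod.map (id : ℝ → ℝ) π) := IsOpenQuotientMap.id.prodMap hπq
  have hπeq {ε : ℝ} {p q : ℝ × ℝ} (h : π p = π q) : H (ε, p) = H (ε, q) :=
    hper ε p q (congrArg Prod.fst h) (congrArg Prod.snd h)
  set Z : Set (ℝ × (Real.Angle × Real.Angle)) := {x | ∃ p, π p = x.2 ∧ H (x.1, p) = 0} with hZ
  have hmem (ε : ℝ) (p : ℝ × ℝ) : (ε, π p) ∈ Z ↔ H (ε, p) = 0 :=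
    ⟨fun ⟨q, hq, h⟩ => (hπeq hq).symm.trans h, fun h => ⟨p, rfl, h⟩⟩
  have hZc : IsClosed Z := by
    rw [← hπq'.isQuotientMap.isClosed_preimage]
    have : Prod.map (id : ℝ → ℝ) π ⁻¹' Z = H ⁻¹' {0} := by
      ext x
      exact hmem x.1 x.2
    rw [this]
    exact isClosed_singleton.preimage hH.continuous
  have hcard (ε : ℝ) : {k | (ε, k) ∈ Z} = π '' {p | p ∈ fundamentalBox ∧ H (ε, p) = 0} := by
    ext k
    constructor
    · rintro ⟨p, rfl, hp⟩
      obtain ⟨q, hq, h1, h2⟩ := exists_mem_fundamentalBox p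
      have hpq : π p = π q := Prod.ext h1 h2
      exact ⟨q, ⟨hq, (hπeq hpq).symm.trans hp⟩, hpq.symm⟩
    · rintro ⟨p, hp, rfl⟩
      exact (hmem ε p).2 hp.2
  have hπinj (ε : ℝ) : Set.InjOn π {p | p ∈ fundamentalBox ∧ H (ε, p) = 0} := fun p hp q hq h =>
    eq_of_mem_fundamentalBox hp.1 hq.1 (congrArg Prod.fst h) (congrArg Prod.snd h)
  have key := finite_and_eventually_encard_eq hZc (fun k hk N hN => ?_) fun k hk => ?_
  · refine ⟨?_, key.2.mono fun ε hε => ?_⟩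
    · have := key.1
      rw [hcard] at this
      exact this.of_finite_image (hπinj 0)
    · rwa [hcard, hcard, (hπinj ε).encard_image, (hπinj 0).encard_image] at hε
  · obtain ⟨z, rfl, hz⟩ := hk
    refine ((eventually_existsUnique_zero hH hz (hinj z hz)).1 (π ⁻¹' N)
      (hπq.continuous.continuousAt.preimage_mem_nhds hN)).mono fun ε hε => ?_
    obtain ⟨p, hpN, hp⟩ := hε
    exact ⟨π p, hpN, p, rfl, hp⟩
  · obtain ⟨z, rfl, hz⟩ := hk
    obtain ⟨U, hU, hUev⟩ := (eventually_existsUnique_zero hH hz (hinj z hz)).2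
    refine ⟨π '' U, hπq.isOpenMap.image_mem_nhds hU, hUev.mono fun ε hε => ?_⟩
    rintro _ ⟨p, hp, rfl⟩ _ ⟨q, hq, rfl⟩ h h'
    rw [hε p hp q hq ((hmem ε p).1 h) ((hmem ε q).1 h')]

/-! ### Counting quadratic points -/

theorem scaledJet_eq (f : ℝ × ℝ → ℝ) (ε : ℝ) (p : ℝ × ℝ) : scaledJet f ε p =
    ⟨ε / 4 * (chartJet f p).c00, ε / 4 * (chartJet f p).c10, ε / 4 * (chartJet f p).c01,
      ε / 4 * (chartJet f p).c20, ε / 4 * (chartJet f p).c11, ε / 4 * (chartJet f p).c02,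
      ε / 4 * (chartJet f p).c30, ε / 4 * (chartJet f p).c21, ε / 4 * (chartJet f p).c12,
      ε / 4 * (chartJet f p).c03⟩ := by
  simp [scaledJet, Jet.mul, Jet.const]

/-- The first obstruction divided by `ε`. -/
noncomputable def reducedX (f : ℝ × ℝ → ℝ) (ε : ℝ) (p : ℝ × ℝ) : ℝ :=
  let G := scaledJet f ε p
  let J := chartJet f p
  (G.det * (G.det * J.c30 + J.c20 * G.tanY) + J.c10 * (G.quadXY + 2 * G.quadX * G.c00)) / 4 *
      G.factorDet -
    (G.det * J.c20 + J.c10 * G.tanY) / 4 * (G.quadXY * G.cubic21 - G.quadX * G.cubic12)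

/-- The second obstruction divided by `ε`. -/
noncomputable def reducedY (f : ℝ × ℝ → ℝ) (ε : ℝ) (p : ℝ × ℝ) : ℝ :=
  let G := scaledJet f ε p
  let J := chartJet f p
  (G.det * (G.det * J.c03 + J.c02 * G.tanX) + J.c01 * (G.quadXY + 2 * G.quadY * G.c00)) / 4 *
      G.factorDet -
    (G.det * J.c02 + J.c01 * G.tanX) / 4 * (G.quadXY * G.cubic12 - G.quadY * G.cubic21)

theorem obstructionX_scaledJet (f : ℝ × ℝ → ℝ) (ε : ℝ) (p : ℝ × ℝ) :
    (scaledJet f ε p).obstructionX = ε * reducedX f ε p := by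
  have h30 : (scaledJet f ε p).c30 = ε / 4 * (chartJet f p).c30 := by rw [scaledJet_eq]
  have h20 : (scaledJet f ε p).c20 = ε / 4 * (chartJet f p).c20 := by rw [scaledJet_eq]
  have h10 : (scaledJet f ε p).c10 = ε / 4 * (chartJet f p).c10 := by rw [scaledJet_eq]
  have hq : (scaledJet f ε p).quadX = ε * (((scaledJet f ε p).det * (chartJet f p).c20 +
      (chartJet f p).c10 * (scaledJet f ε p).tanY) / 4) := by
    rw [Jet.quadX, h20, h10]; ring
  have hc : (scaledJet f ε p).cubic30 = ε * (((scaledJet f ε p).det * ((scaledJet f ε p).det *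
      (chartJet f p).c30 + (chartJet f p).c20 * (scaledJet f ε p).tanY) + (chartJet f p).c10 *
      ((scaledJet f ε p).quadXY + 2 * (scaledJet f ε p).quadX * (scaledJet f ε p).c00)) / 4) := by
    rw [Jet.cubic30, h30, h20, h10]; ring
  simp only [Jet.obstructionX, reducedX]
  rw [hc]
  linear_combination (-((scaledJet f ε p).quadXY * (scaledJet f ε p).cubic21 -
    (scaledJet f ε p).quadX * (scaledJet f ε p).cubic12)) * hq

theorem obstructionY_scaledJet (f : ℝ × ℝ → ℝ) (ε : ℝ) (p : ℝ × ℝ) :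
    (scaledJet f ε p).obstructionY = ε * reducedY f ε p := by
  have h03 : (scaledJet f ε p).c03 = ε / 4 * (chartJet f p).c03 := by rw [scaledJet_eq]
  have h02 : (scaledJet f ε p).c02 = ε / 4 * (chartJet f p).c02 := by rw [scaledJet_eq]
  have h01 : (scaledJet f ε p).c01 = ε / 4 * (chartJet f p).c01 := by rw [scaledJet_eq]
  have hq : (scaledJet f ε p).quadY = ε * (((scaledJet f ε p).det * (chartJet f p).c02 +
      (chartJet f p).c01 * (scaledJet f ε p).tanX) / 4) := by
    rw [Jet.quadY, h02, h01]; ring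
  have hc : (scaledJet f ε p).cubic03 = ε * (((scaledJet f ε p).det * ((scaledJet f ε p).det *
      (chartJet f p).c03 + (chartJet f p).c02 * (scaledJet f ε p).tanX) + (chartJet f p).c01 *
      ((scaledJet f ε p).quadXY + 2 * (scaledJet f ε p).quadY * (scaledJet f ε p).c00)) / 4) := by
    rw [Jet.cubic03, h03, h02, h01]; ring
  simp only [Jet.obstructionY, reducedY]
  rw [hc]
  linear_combination (-((scaledJet f ε p).quadXY * (scaledJet f ε p).cubic12 -
    (scaledJet f ε p).quadY * (scaledJet f ε p).cubic21)) * hq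

theorem scaledJet_zero (f : ℝ × ℝ → ℝ) (p : ℝ × ℝ) : scaledJet f 0 p = Jet.const 0 := by
  simp [scaledJet_eq, Jet.const]

/-- To first order in `ε`, the first obstruction is a multiple of `f_uuu + f_u`. In the chart
`tanChart p` the coefficients of `x` and `x ^ 3` are `2 f_u` and `(4 f_uuu - 2 f_u) / 3`, with sum
`4 (f_uuu + f_u) / 3`. -/
theorem reducedX_zero {f : ℝ × ℝ → ℝ} (hf : ContDiff ℝ ∞ f) (p : ℝ × ℝ) :
    reducedX f 0 p = operatorU f p / 3 := by
  simp only [reducedX, scaledJet_zero]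
  simp [Jet.const, Jet.det, Jet.tanX, Jet.tanY, Jet.quadX, Jet.quadXY, Jet.quadY, Jet.factorDet,
    Jet.cubic21, Jet.cubic12, operatorU_eq hf, chartJet]
  ring

/-- To first order in `ε`, the second obstruction is a multiple of `f_vvv + f_v`. -/
theorem reducedY_zero {f : ℝ × ℝ → ℝ} (hf : ContDiff ℝ ∞ f) (p : ℝ × ℝ) :
    reducedY f 0 p = operatorV f p / 3 := by
  simp only [reducedY, scaledJet_zero]
  simp [Jet.const, Jet.det, Jet.tanX, Jet.tanY, Jet.quadX, Jet.quadXY, Jet.quadY, Jet.factorDet,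
    Jet.cubic21, Jet.cubic12, operatorV_eq hf, chartJet]
  ring

theorem IsTorusPeriodic.chartJet {f : ℝ × ℝ → ℝ} (h : IsTorusPeriodic f) :
    IsTorusPeriodic (chartJet f) := by
  intro p q h1 h2
  simp only [HyperboloidPerturbation.chartJet, h p q h1 h2, h.partialU p q h1 h2,
    h.partialV p q h1 h2, h.partialU.partialU p q h1 h2, h.partialV.partialU p q h1 h2,
    h.partialV.partialV p q h1 h2, h.partialU.partialU.partialU p q h1 h2,
    h.partialV.partialU.partialU p q h1 h2, h.partialV.partialV.partialU p q h1 h2,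
    h.partialV.partialV.partialV p q h1 h2]

theorem isTorusPeriodic_reduced {f : ℝ × ℝ → ℝ} (h : IsTorusPeriodic f) (ε : ℝ) :
    IsTorusPeriodic fun p => (reducedX f ε p, reducedY f ε p) := by
  intro p q h1 h2
  simp only [reducedX, reducedY, scaledJet, h.chartJet p q h1 h2]

/-- A family of polynomials whose coefficients depend smoothly on the parameter. -/
structure IsSmoothJet (J : ℝ × (ℝ × ℝ) → Jet) : Prop where
  c00 : ContDiff ℝ ∞ fun x => (J x).c00
  c10 : ContDiff ℝ ∞ fun x => (J x).c10
  c01 : ContDiff ℝ ∞ fun x => (J x).c01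
  c20 : ContDiff ℝ ∞ fun x => (J x).c20
  c11 : ContDiff ℝ ∞ fun x => (J x).c11
  c02 : ContDiff ℝ ∞ fun x => (J x).c02
  c30 : ContDiff ℝ ∞ fun x => (J x).c30
  c21 : ContDiff ℝ ∞ fun x => (J x).c21
  c12 : ContDiff ℝ ∞ fun x => (J x).c12
  c03 : ContDiff ℝ ∞ fun x => (J x).c03

theorem isSmoothJet_chartJet {f : ℝ × ℝ → ℝ} (hf : ContDiff ℝ ∞ f) :
    IsSmoothJet fun x => chartJet f x.2 := by
  have hu := contDiff_partialU hf
  have hv := contDiff_partialV hf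
  have huu := contDiff_partialU hu
  have huv := contDiff_partialU hv
  have hvv := contDiff_partialV hv
  have huuu := contDiff_partialU huu
  have huuv := contDiff_partialU huv
  have huvv := contDiff_partialU hvv
  have hvvv := contDiff_partialV hvv
  constructor <;> simp only [chartJet] <;> fun_prop

theorem isSmoothJet_scaledJet {f : ℝ × ℝ → ℝ} (hf : ContDiff ℝ ∞ f) :
    IsSmoothJet fun x => scaledJet f x.1 x.2 := by
  obtain ⟨a1, a2, a3, a4, a5, a6, a7, a8, a9, a10⟩ := isSmoothJet_chartJet hf
  constructor <;> simp only [scaledJet_eq] <;> fun_prop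

namespace IsSmoothJet

variable {J : ℝ × (ℝ × ℝ) → Jet}

theorem det (hJ : IsSmoothJet J) : ContDiff ℝ ∞ fun x => (J x).det := by
  have := hJ.c00
  unfold Jet.det
  fun_prop

theorem tanX (hJ : IsSmoothJet J) : ContDiff ℝ ∞ fun x => (J x).tanX := by
  have := hJ.c00
  have := hJ.c10
  have := hJ.c01
  unfold Jet.tanX
  fun_prop

theorem tanY (hJ : IsSmoothJet J) : ContDiff ℝ ∞ fun x => (J x).tanY := by
  have := hJ.c00
  have := hJ.c10
  have := hJ.c01
  unfold Jet.tanY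
  fun_prop

theorem quadX (hJ : IsSmoothJet J) : ContDiff ℝ ∞ fun x => (J x).quadX := by
  have := hJ.det
  have := hJ.c20
  have := hJ.c10
  have := hJ.tanY
  unfold Jet.quadX
  fun_prop

theorem quadXY (hJ : IsSmoothJet J) : ContDiff ℝ ∞ fun x => (J x).quadXY := by
  have := hJ.det
  have := hJ.c11
  have := hJ.c10
  have := hJ.c01
  have := hJ.tanX
  have := hJ.tanY
  unfold Jet.quadXY
  fun_prop

theorem quadY (hJ : IsSmoothJet J) : ContDiff ℝ ∞ fun x => (J x).quadY := by
  have := hJ.det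
  have := hJ.c02
  have := hJ.c01
  have := hJ.tanX
  unfold Jet.quadY
  fun_prop

theorem cubic21 (hJ : IsSmoothJet J) : ContDiff ℝ ∞ fun x => (J x).cubic21 := by
  have := hJ.det
  have := hJ.c00
  have := hJ.c10
  have := hJ.c01
  have := hJ.c20
  have := hJ.c11
  have := hJ.c21
  have := hJ.tanX
  have := hJ.tanY
  have := hJ.quadX
  have := hJ.quadXY
  have := hJ.quadY
  unfold Jet.cubic21
  fun_prop

theorem cubic12 (hJ : IsSmoothJet J) : ContDiff ℝ ∞ fun x => (J x).cubic12 := by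
  have := hJ.det
  have := hJ.c00
  have := hJ.c10
  have := hJ.c01
  have := hJ.c11
  have := hJ.c02
  have := hJ.c12
  have := hJ.tanX
  have := hJ.tanY
  have := hJ.quadX
  have := hJ.quadXY
  have := hJ.quadY
  unfold Jet.cubic12
  fun_prop

theorem factorDet (hJ : IsSmoothJet J) : ContDiff ℝ ∞ fun x => (J x).factorDet := by
  have := hJ.quadX
  have := hJ.quadXY
  have := hJ.quadY
  unfold Jet.factorDet
  fun_prop

end IsSmoothJet

theorem contDiff_reducedX {f : ℝ × ℝ → ℝ} (hf : ContDiff ℝ ∞ f) :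
    ContDiff ℝ ∞ fun x : ℝ × (ℝ × ℝ) => reducedX f x.1 x.2 := by
  have hJ := isSmoothJet_chartJet hf
  have hG := isSmoothJet_scaledJet hf
  have := hJ.c10
  have := hJ.c20
  have := hJ.c30
  have := hG.c00
  have := hG.det
  have := hG.tanY
  have := hG.quadX
  have := hG.quadXY
  have := hG.factorDet
  have := hG.cubic21
  have := hG.cubic12
  simp only [reducedX]
  fun_prop

theorem contDiff_reducedY {f : ℝ × ℝ → ℝ} (hf : ContDiff ℝ ∞ f) :
    ContDiff ℝ ∞ fun x : ℝ × (ℝ × ℝ) => reducedY f x.1 x.2 := by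
  have hJ := isSmoothJet_chartJet hf
  have hG := isSmoothJet_scaledJet hf
  have := hJ.c01
  have := hJ.c02
  have := hJ.c03
  have := hG.c00
  have := hG.det
  have := hG.tanX
  have := hG.quadY
  have := hG.quadXY
  have := hG.factorDet
  have := hG.cubic21
  have := hG.cubic12
  simp only [reducedY]
  fun_prop

/-- For small `ε` the second fundamental form stays close to `x * y`, uniformly on the torus. -/
theorem eventually_nondegenerate (f : SmoothTorusFunction) :
    ∀ᶠ ε in 𝓝 (0 : ℝ), (∀ p, |ε / 4 * f.toFun p| < 1) ∧ ∀ p ∈ fundamentalBox,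
      (scaledJet f.toFun ε p).factorDet ≠ 0 ∧
      4 * ((scaledJet f.toFun ε p).quadX * (scaledJet f.toFun ε p).quadY) ≠
        (scaledJet f.toFun ε p).quadXY ^ 2 := by
  have h1 : ∀ᶠ ε in 𝓝 (0 : ℝ), ∀ p, |ε / 4 * f.toFun p| < 1 := by
    obtain ⟨C, hC⟩ := (isTorusPeriodic_toFun f).exists_norm_le f.smooth.continuous
    have ht : Tendsto (fun ε : ℝ => |ε / 4| * C) (𝓝 0) (𝓝 0) := by
      simpa using (by fun_prop : Continuous fun ε : ℝ => |ε / 4| * C).tendsto 0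
    filter_upwards [ht.eventually_lt_const one_pos] with ε hε p
    rw [abs_mul]
    exact (mul_le_mul_of_nonneg_left (hC p) (abs_nonneg _)).trans_lt hε
  have hG := isSmoothJet_scaledJet f.smooth
  have hK : IsCompact (Set.Icc (0 : ℝ) (2 * Real.pi) ×ˢ Set.Icc (0 : ℝ) (2 * Real.pi)) :=
    isCompact_Icc.prod isCompact_Icc
  have h2 := hK.eventually_forall_of_forall_eventually (x₀ := (0 : ℝ))
    (P := fun ε p => (scaledJet f.toFun ε p).factorDet ≠ 0 ∧
      4 * ((scaledJet f.toFun ε p).quadX * (scaledJet f.toFun ε p).quadY) ≠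
        (scaledJet f.toFun ε p).quadXY ^ 2) fun p _ => by
    have c1 := hG.factorDet.continuous
    have c2 := hG.quadX.continuous
    have c3 := hG.quadY.continuous
    have c4 := hG.quadXY.continuous
    have c5 : Continuous fun x : ℝ × (ℝ × ℝ) => 4 * ((scaledJet f.toFun x.1 x.2).quadX *
        (scaledJet f.toFun x.1 x.2).quadY) - (scaledJet f.toFun x.1 x.2).quadXY ^ 2 := by fun_prop
    refine (c1.continuousAt.eventually_ne ?_).and
      ((c5.continuousAt.eventually_ne ?_).mono fun x hx => sub_ne_zero.1 hx)
    · simp [scaledJet_zero, Jet.factorDet, Jet.quadX, Jet.quadXY, Jet.quadY, Jet.det, Jet.const]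
    · simp [scaledJet_zero, Jet.quadX, Jet.quadXY, Jet.quadY, Jet.det, Jet.const]
  filter_upwards [h1, h2] with ε h1 h2
  exact ⟨h1, fun p hp => h2 p ⟨Set.Ico_subset_Icc_self hp.1, Set.Ico_subset_Icc_self hp.2⟩⟩

/-- The quadratic points correspond to the zeros of the reduced obstructions in the fundamental
domain. -/
theorem encard_isQuadraticPoint_eq {f : SmoothTorusFunction} {ε : ℝ} (hε : ε ≠ 0)
    (h : ∀ p, |ε / 4 * f.toFun p| < 1) (hnd : ∀ p ∈ fundamentalBox,
      (scaledJet f.toFun ε p).factorDet ≠ 0 ∧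
      4 * ((scaledJet f.toFun ε p).quadX * (scaledJet f.toFun ε p).quadY) ≠
        (scaledJet f.toFun ε p).quadXY ^ 2) :
    {m | IsQuadraticPoint (perturbedSurface f.toFun ε) m}.encard =
      {p | p ∈ fundamentalBox ∧ (reducedX f.toFun ε p, reducedY f.toFun ε p) = 0}.encard := by
  have hinj : Set.InjOn (surfacePoint f.toFun ε)
      {p | p ∈ fundamentalBox ∧ (reducedX f.toFun ε p, reducedY f.toFun ε p) = 0} :=
    fun p hp q hq hpq => eq_of_mem_fundamentalBox hp.1 hq.1 (surfacePoint_injective h hpq).1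
      (surfacePoint_injective h hpq).2
  have key : ∀ p ∈ fundamentalBox,
      IsQuadraticPoint (perturbedSurface f.toFun ε) (surfacePoint f.toFun ε p) ↔
        (reducedX f.toFun ε p, reducedY f.toFun ε p) = 0 := by
    intro p hp
    rw [isQuadraticPoint_iff h p (hnd p hp).1 (hnd p hp).2, obstructionX_scaledJet,
      obstructionY_scaledJet, mul_eq_zero_iff_left hε, mul_eq_zero_iff_left hε]
    exact Prod.mk_eq_zero.symm
  rw [← hinj.encard_image]
  congr 1
  ext m
  constructor
  · intro hm
    obtain ⟨p, rfl⟩ := hm.1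
    obtain ⟨q, hq, h1, h2⟩ := exists_mem_fundamentalBox p
    have e : surfacePoint f.toFun ε p = surfacePoint f.toFun ε q := surfacePoint_periodic f ε h1 h2
    exact ⟨q, ⟨hq, (key q hq).1 (e ▸ hm)⟩, e.symm⟩
  · rintro ⟨p, hp, rfl⟩
    exact (key p hp.1).2 hp.2

theorem eq_zero_of_det_ne_zero {E : Type*} [NormedAddCommGroup E] [NormedSpace ℝ E]
    [FiniteDimensional ℝ E] {L : E →L[ℝ] E} (hL : L.det ≠ 0) {w : E} (hw : L w = 0) : w = 0 := by
  have h1 : IsUnit (L : E →ₗ[ℝ] E) :=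
    (LinearMap.isUnit_iff_isUnit_det _).2 (Ne.isUnit hL)
  exact LinearMap.ker_eq_bot'.1 ((LinearMap.isUnit_iff_ker_eq_bot _).1 h1) w hw

theorem finite_solutionSet_and_eventually_encard_eq {f : SmoothTorusFunction}
    (hf : HasSimpleSolutions f.toFun) :
    (solutionSet f.toFun).Finite ∧ ∀ᶠ ε in 𝓝 (0 : ℝ), ε ≠ 0 →
      {m | IsQuadraticPoint (perturbedSurface f.toFun ε) m}.encard =
        (solutionSet f.toFun).encard := by
  set H : ℝ × (ℝ × ℝ) → ℝ × ℝ :=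
    fun x => (reducedX f.toFun x.1 x.2, reducedY f.toFun x.1 x.2) with hH
  set F : ℝ × ℝ → ℝ × ℝ := fun q => (operatorU f.toFun q, operatorV f.toFun q) with hF
  have hHs : ContDiff ℝ ∞ H := (contDiff_reducedX f.smooth).prodMk (contDiff_reducedY f.smooth)
  have hper (ε : ℝ) : IsTorusPeriodic fun p => H (ε, p) :=
    isTorusPeriodic_reduced (isTorusPeriodic_toFun f) ε
  have hH0 : (fun p => H (0, p)) = fun p => (3 : ℝ)⁻¹ • F p := by
    funext p
    simp only [hH, hF, reducedX_zero f.smooth, reducedY_zero f.smooth, Prod.smul_mk, smul_eq_mul,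
      div_eq_inv_mul]
  have hsol : {p | p ∈ fundamentalBox ∧ H (0, p) = 0} = solutionSet f.toFun := by
    ext p
    have : H (0, p) = (3 : ℝ)⁻¹ • F p := congrFun hH0 p
    simp [this, solutionSet, fundamentalBox, hF]
  have hFd : Differentiable ℝ F :=
    ((contDiff_operatorU f.smooth).prodMk (contDiff_operatorV f.smooth)).differentiable (by simp)
  have hinj : ∀ z, H (0, z) = 0 → ∀ w, fderiv ℝ (fun p => H (0, p)) z w = 0 → w = 0 := by
    intro z hz w hw
    obtain ⟨q, hq, h1, h2⟩ := exists_mem_fundamentalBox z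
    rw [(hper 0).fderiv z q h1 h2, hH0, fderiv_fun_const_smul (hFd q)] at hw
    have hq' : q ∈ solutionSet f.toFun := by
      rw [← hsol]
      exact ⟨hq, (hper 0 z q h1 h2).symm.trans hz⟩
    refine eq_zero_of_det_ne_zero (hf q hq') ?_
    simpa using hw
  have key := finite_and_eventually_encard_zeros_eq hHs hper hinj
  rw [hsol] at key
  refine ⟨key.1, ?_⟩
  filter_upwards [key.2, eventually_nondegenerate f] with ε h1 h2 hε
  rw [← h1, encard_isQuadraticPoint_eq hε h2.1 h2.2]

/-! ### The `C^∞` topology -/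

theorem tendsto_nhds_iff_tendstoUniformly {ι : Type*} {l : Filter ι} {F : ι → SmoothTorusFunction}
    {f : SmoothTorusFunction} :
    Tendsto F l (𝓝 f) ↔ ∀ k : ℕ, TendstoUniformly (fun i => iteratedFDeriv ℝ k (F i).toFun)
      (iteratedFDeriv ℝ k f.toFun) l := by
  rw [nhds_induced, tendsto_comap_iff, tendsto_pi_nhds]
  exact forall_congr' fun k => UniformFun.tendsto_iff_tendstoUniformly

theorem iteratedFDeriv_succ_eq_curry (f : ℝ × ℝ → ℝ) (k : ℕ) :
    iteratedFDeriv ℝ (k + 1) f = fun p =>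
      (continuousMultilinearCurryLeftEquiv ℝ (fun _ : Fin (k + 1) => ℝ × ℝ) ℝ).symm
        (fderiv ℝ (iteratedFDeriv ℝ k f) p) := by
  rfl

theorem IsTorusPeriodic.iteratedFDeriv {φ : ℝ × ℝ → ℝ} (h : IsTorusPeriodic φ) (k : ℕ) :
    IsTorusPeriodic (iteratedFDeriv ℝ k φ) := by
  induction k with
  | zero =>
    intro p q h1 h2
    ext m
    simpa using h p q h1 h2
  | succ k ih =>
    intro p q h1 h2
    simp only [iteratedFDeriv_succ_eq_curry, ih.fderiv p q h1 h2]

/-- The derivatives of orders one to four, which decide whether a point is a solution and whether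
it is simple. -/
abbrev JetSpace : Type :=
  (((ℝ × ℝ) [×1]→L[ℝ] ℝ) × ((ℝ × ℝ) [×2]→L[ℝ] ℝ)) ×
    (((ℝ × ℝ) [×3]→L[ℝ] ℝ) × ((ℝ × ℝ) [×4]→L[ℝ] ℝ))

/-- The derivatives of orders one to four of a function at a point. -/
noncomputable def fullJet (f : ℝ × ℝ → ℝ) (p : ℝ × ℝ) : JetSpace :=
  ((iteratedFDeriv ℝ 1 f p, iteratedFDeriv ℝ 2 f p),
    (iteratedFDeriv ℝ 3 f p, iteratedFDeriv ℝ 4 f p))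

/-- The pair of values of a `k`-linear form on the diagonal at the two unit vectors. -/
noncomputable def diagonalValues (k : ℕ) : ((ℝ × ℝ) [×k]→L[ℝ] ℝ) →L[ℝ] ℝ × ℝ :=
  (ContinuousMultilinearMap.apply ℝ (fun _ : Fin k => ℝ × ℝ) ℝ fun _ => (1, 0)).prod
    (ContinuousMultilinearMap.apply ℝ (fun _ : Fin k => ℝ × ℝ) ℝ fun _ => (0, 1))

theorem fderiv_iteratedFDeriv_apply_const {f : ℝ × ℝ → ℝ} (hf : ContDiff ℝ ∞ f) (k : ℕ)
    (e p : ℝ × ℝ) : fderiv ℝ (fun q => iteratedFDeriv ℝ k f q fun _ => e) p e =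
      iteratedFDeriv ℝ (k + 1) f p fun _ => e := by
  have hd : DifferentiableAt ℝ (iteratedFDeriv ℝ k f) p :=
    hf.differentiable_iteratedFDeriv (by exact_mod_cast WithTop.coe_lt_top k) p
  rw [iteratedFDeriv_succ_apply_left]
  have h1 : HasFDerivAt (fun q => iteratedFDeriv ℝ k f q fun _ => e) _ p :=
    (ContinuousMultilinearMap.apply ℝ (fun _ : Fin k => ℝ × ℝ) ℝ
      fun _ => e).hasFDerivAt.comp p hd.hasFDerivAt
  rw [h1.fderiv]
  rfl

theorem operatorU_eq_iteratedFDeriv {f : ℝ × ℝ → ℝ} (hf : ContDiff ℝ ∞ f) (p : ℝ × ℝ) :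
    operatorU f p =
      iteratedFDeriv ℝ 3 f p (fun _ => (1, 0)) + iteratedFDeriv ℝ 1 f p fun _ => (1, 0) := by
  have h1 : partialU f = fun p => iteratedFDeriv ℝ 1 f p fun _ => (1, 0) := by
    funext p
    rw [iteratedFDeriv_one_apply]
    rfl
  have h2 (k : ℕ) : partialU (fun p => iteratedFDeriv ℝ k f p fun _ => (1, 0)) =
      fun p => iteratedFDeriv ℝ (k + 1) f p fun _ => (1, 0) :=
    funext fun p => fderiv_iteratedFDeriv_apply_const hf k (1, 0) p
  rw [operatorU_eq hf, h1, h2, h2]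

theorem operatorV_eq_iteratedFDeriv {f : ℝ × ℝ → ℝ} (hf : ContDiff ℝ ∞ f) (p : ℝ × ℝ) :
    operatorV f p =
      iteratedFDeriv ℝ 3 f p (fun _ => (0, 1)) + iteratedFDeriv ℝ 1 f p fun _ => (0, 1) := by
  have h1 : partialV f = fun p => iteratedFDeriv ℝ 1 f p fun _ => (0, 1) := by
    funext p
    rw [iteratedFDeriv_one_apply]
    rfl
  have h2 (k : ℕ) : partialV (fun p => iteratedFDeriv ℝ k f p fun _ => (0, 1)) =
      fun p => iteratedFDeriv ℝ (k + 1) f p fun _ => (0, 1) :=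
    funext fun p => fderiv_iteratedFDeriv_apply_const hf k (0, 1) p
  rw [operatorV_eq hf, h1, h2, h2]

/-- The value and the derivative of `(f_uuu + f_u, f_vvv + f_v)` in terms of the derivatives
of `f`. -/
noncomputable def systemOfJet (ξ : JetSpace) : (ℝ × ℝ) × (ℝ × ℝ →L[ℝ] ℝ × ℝ) :=
  (diagonalValues 3 ξ.2.1 + diagonalValues 1 ξ.1.1,
    (diagonalValues 3).comp
        (continuousMultilinearCurryLeftEquiv ℝ (fun _ : Fin 4 => ℝ × ℝ) ℝ ξ.2.2) +
      (diagonalValues 1).comp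
        (continuousMultilinearCurryLeftEquiv ℝ (fun _ : Fin 2 => ℝ × ℝ) ℝ ξ.1.2))

theorem continuous_systemOfJet : Continuous systemOfJet := by
  unfold systemOfJet
  fun_prop

theorem systemOfJet_fullJet {f : ℝ × ℝ → ℝ} (hf : ContDiff ℝ ∞ f) (p : ℝ × ℝ) :
    systemOfJet (fullJet f p) = ((operatorU f p, operatorV f p),
      fderiv ℝ (fun q : ℝ × ℝ => (operatorU f q, operatorV f q)) p) := by
  have hF : (fun q : ℝ × ℝ => (operatorU f q, operatorV f q)) = fun q =>
      diagonalValues 3 (iteratedFDeriv ℝ 3 f q) + diagonalValues 1 (iteratedFDeriv ℝ 1 f q) := by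
    funext q
    rw [operatorU_eq_iteratedFDeriv hf, operatorV_eq_iteratedFDeriv hf]
    rfl
  have hd (k : ℕ) : HasFDerivAt (iteratedFDeriv ℝ k f) (fderiv ℝ (iteratedFDeriv ℝ k f) p) p :=
    (hf.differentiable_iteratedFDeriv (by exact_mod_cast WithTop.coe_lt_top k) p).hasFDerivAt
  have h1 : HasFDerivAt (fun q => diagonalValues 3 (iteratedFDeriv ℝ 3 f q) +
      diagonalValues 1 (iteratedFDeriv ℝ 1 f q)) _ p :=
    ((diagonalValues 3).hasFDerivAt.comp p (hd 3)).add
      ((diagonalValues 1).hasFDerivAt.comp p (hd 1))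
  rw [hF, h1.fderiv]
  refine Prod.ext (congrFun hF p).symm ?_
  simp only [systemOfJet, fullJet, iteratedFDeriv_succ_eq_curry f 3,
    iteratedFDeriv_succ_eq_curry f 1, LinearIsometryEquiv.apply_symm_apply]

/-- By periodicity the condition holds at all points, not only in the fundamental domain. -/
theorem hasSimpleSolutions_iff (f : SmoothTorusFunction) :
    HasSimpleSolutions f.toFun ↔ ∀ p, systemOfJet (fullJet f.toFun p) ∈
      {x : (ℝ × ℝ) × (ℝ × ℝ →L[ℝ] ℝ × ℝ) | x.1 ≠ 0 ∨ x.2.det ≠ 0} := by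
  have hper : IsTorusPeriodic (fullJet f.toFun) := by
    intro p q h1 h2
    have h (k : ℕ) := (isTorusPeriodic_toFun f).iteratedFDeriv k p q h1 h2
    simp only [fullJet, h]
  constructor
  · intro h p
    obtain ⟨q, hq, h1, h2⟩ := exists_mem_fundamentalBox p
    rw [hper p q h1 h2, systemOfJet_fullJet f.smooth]
    by_cases h0 : (operatorU f.toFun q, operatorV f.toFun q) = 0
    · exact Or.inr (h q ⟨hq, Prod.mk_eq_zero.1 h0⟩)
    · exact Or.inl h0
  · intro h p hp
    have := h p
    rw [systemOfJet_fullJet f.smooth] at this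
    exact this.resolve_left fun h0 => h0 (Prod.mk_eq_zero.2 hp.2)

/-- The derivatives up to order four of a generic function fill a compact subset of an open set, and
nearby functions keep theirs in that open set. -/
theorem isOpen_hasSimpleSolutions :
    IsOpen {f : SmoothTorusFunction | HasSimpleSolutions f.toFun} := by
  have hO : IsOpen {x : (ℝ × ℝ) × (ℝ × ℝ →L[ℝ] ℝ × ℝ) | x.1 ≠ 0 ∨ x.2.det ≠ 0} := by
    refine IsOpen.union ?_ ?_
    · exact isOpen_ne_fun continuous_fst continuous_const
    · exact isOpen_ne_fun (ContinuousLinearMap.continuous_det.comp continuous_snd) continuous_const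
  have hO' := hO.preimage continuous_systemOfJet
  refine isOpen_iff_mem_nhds.2 fun f hf => ?_
  have hcont : Continuous (fullJet f.toFun) := by
    have (k : ℕ) : Continuous (iteratedFDeriv ℝ k f.toFun) :=
      f.smooth.continuous_iteratedFDeriv (by exact_mod_cast le_top)
    exact ((this 1).prodMk (this 2)).prodMk ((this 3).prodMk (this 4))
  have hK : IsCompact (fullJet f.toFun ''
      (Set.Icc (0 : ℝ) (2 * Real.pi) ×ˢ Set.Icc (0 : ℝ) (2 * Real.pi))) :=
    (isCompact_Icc.prod isCompact_Icc).image hcont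
  obtain ⟨δ, hδ, hsub⟩ := hK.exists_thickening_subset_open hO' <| by
    rintro _ ⟨p, -, rfl⟩
    exact (hasSimpleSolutions_iff f).1 hf p
  have hu := tendsto_nhds_iff_tendstoUniformly.1 (tendsto_id : Tendsto id (𝓝 f) (𝓝 f))
  have hk (k : ℕ) : ∀ᶠ g : SmoothTorusFunction in 𝓝 f, ∀ p,
      dist (iteratedFDeriv ℝ k f.toFun p) (iteratedFDeriv ℝ k g.toFun p) < δ :=
    Metric.tendstoUniformly_iff.1 (hu k) δ hδ
  filter_upwards [hk 1, hk 2, hk 3, hk 4] with g h1 h2 h3 h4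
  intro p hp
  have hp' : p ∈ Set.Icc (0 : ℝ) (2 * Real.pi) ×ˢ Set.Icc (0 : ℝ) (2 * Real.pi) :=
    ⟨Set.Ico_subset_Icc_self hp.1.1, Set.Ico_subset_Icc_self hp.1.2⟩
  have hmem : fullJet g.toFun p ∈ Metric.thickening δ (fullJet f.toFun ''
      (Set.Icc (0 : ℝ) (2 * Real.pi) ×ˢ Set.Icc (0 : ℝ) (2 * Real.pi))) := by
    refine Metric.mem_thickening_iff.2 ⟨_, Set.mem_image_of_mem _ hp', ?_⟩
    rw [dist_comm]
    exact max_lt (max_lt (h1 p) (h2 p)) (max_lt (h3 p) (h4 p))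
  have := hsub hmem
  rw [Set.mem_preimage, systemOfJet_fullJet g.smooth] at this
  exact this.resolve_left fun h0 => h0 (Prod.mk_eq_zero.2 hp.2)

/-! ### Density of the generic functions -/

/-- The trigonometric perturbations; `c` collects the coefficients of `cos 2u`, `sin 2u`, `cos 2v`
and `sin 2v`. -/
noncomputable def trigPoly (c : (ℝ × ℝ) × (ℝ × ℝ)) (p : ℝ × ℝ) : ℝ :=
  c.1.1 * Real.cos (2 * p.1) + c.1.2 * Real.sin (2 * p.1) + c.2.1 * Real.cos (2 * p.2) +
    c.2.2 * Real.sin (2 * p.2)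

theorem contDiff_trigPoly (c : (ℝ × ℝ) × (ℝ × ℝ)) : ContDiff ℝ ∞ (trigPoly c) := by
  unfold trigPoly
  fun_prop

/-- The perturbation of a function on the torus by a trigonometric polynomial. -/
noncomputable def addTrigPoly (f : SmoothTorusFunction) (c : (ℝ × ℝ) × (ℝ × ℝ)) :
    SmoothTorusFunction where
  toFun p := f.toFun p + trigPoly c p
  smooth := f.smooth.add (contDiff_trigPoly c)
  periodic_fst u v := by
    have : 2 * (u + 2 * Real.pi) = 2 * u + (2 : ℕ) * (2 * Real.pi) := by push_cast; ring
    simp only [f.periodic_fst, trigPoly, this, Real.cos_add_nat_mul_two_pi,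
      Real.sin_add_nat_mul_two_pi]
  periodic_snd u v := by
    have : 2 * (v + 2 * Real.pi) = 2 * v + (2 : ℕ) * (2 * Real.pi) := by push_cast; ring
    simp only [f.periodic_snd, trigPoly, this, Real.cos_add_nat_mul_two_pi,
      Real.sin_add_nat_mul_two_pi]

theorem isTorusPeriodic_trigPoly (c : (ℝ × ℝ) × (ℝ × ℝ)) : IsTorusPeriodic (trigPoly c) := by
  have h := isTorusPeriodic_toFun (addTrigPoly ⟨fun _ => 0, contDiff_const, by simp, by simp⟩ c)
  simpa [addTrigPoly] using h

theorem hasDerivAt_trig (a b x : ℝ) :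
    HasDerivAt (fun s : ℝ => a * Real.cos (2 * s) + b * Real.sin (2 * s))
      (2 * b * Real.cos (2 * x) + -2 * a * Real.sin (2 * x)) x := by
  have h := (hasDerivAt_id' x).const_mul 2
  exact ((h.cos.const_mul a).add (h.sin.const_mul b)).congr_deriv (by ring)

theorem partialU_add_trigPoly {g : ℝ × ℝ → ℝ} (hg : ContDiff ℝ ∞ g) (c : (ℝ × ℝ) × (ℝ × ℝ)) :
    partialU (fun p => g p + trigPoly c p) =
      fun p => partialU g p + trigPoly ((2 * c.1.2, -2 * c.1.1), 0) p := by
  funext p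
  refine (hasDerivAt_partialU (hg.add (contDiff_trigPoly c)) p).unique
    ((hasDerivAt_partialU hg p).add ?_)
  refine (((hasDerivAt_trig c.1.1 c.1.2 p.1).add_const (c.2.1 * Real.cos (2 * p.2))).add_const
    (c.2.2 * Real.sin (2 * p.2))).congr_deriv ?_
  simp [trigPoly]

theorem partialV_add_trigPoly {g : ℝ × ℝ → ℝ} (hg : ContDiff ℝ ∞ g) (c : (ℝ × ℝ) × (ℝ × ℝ)) :
    partialV (fun p => g p + trigPoly c p) =
      fun p => partialV g p + trigPoly (0, (2 * c.2.2, -2 * c.2.1)) p := by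
  funext p
  refine (hasDerivAt_partialV (hg.add (contDiff_trigPoly c)) p).unique
    ((hasDerivAt_partialV hg p).add ?_)
  refine ((hasDerivAt_trig c.2.1 c.2.2 p.2).const_add
    (c.1.1 * Real.cos (2 * p.1) + c.1.2 * Real.sin (2 * p.1))).congr_of_eventuallyEq
    (Eventually.of_forall fun t => ?_) |>.congr_deriv ?_
  · simp only [trigPoly]; ring
  · simp [trigPoly]

theorem operatorU_addTrigPoly (f : SmoothTorusFunction) (c : (ℝ × ℝ) × (ℝ × ℝ)) (p : ℝ × ℝ) :
    operatorU (addTrigPoly f c).toFun p = operatorU f.toFun p +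
      6 * (c.1.1 * Real.sin (2 * p.1) - c.1.2 * Real.cos (2 * p.1)) := by
  have hu := contDiff_partialU f.smooth
  rw [operatorU_eq (addTrigPoly f c).smooth, operatorU_eq f.smooth]
  simp only [addTrigPoly]
  rw [partialU_add_trigPoly f.smooth, partialU_add_trigPoly hu,
    partialU_add_trigPoly (contDiff_partialU hu)]
  simp only [trigPoly, Prod.fst_zero, Prod.snd_zero]
  ring

theorem operatorV_addTrigPoly (f : SmoothTorusFunction) (c : (ℝ × ℝ) × (ℝ × ℝ)) (p : ℝ × ℝ) :
    operatorV (addTrigPoly f c).toFun p = operatorV f.toFun p +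
      6 * (c.2.1 * Real.sin (2 * p.2) - c.2.2 * Real.cos (2 * p.2)) := by
  have hv := contDiff_partialV f.smooth
  rw [operatorV_eq (addTrigPoly f c).smooth, operatorV_eq f.smooth]
  simp only [addTrigPoly]
  rw [partialV_add_trigPoly f.smooth, partialV_add_trigPoly hv,
    partialV_add_trigPoly (contDiff_partialV hv)]
  simp only [trigPoly, Prod.fst_zero, Prod.snd_zero]
  ring

theorem tendsto_addTrigPoly (f : SmoothTorusFunction) :
    Tendsto (addTrigPoly f) (𝓝 0) (𝓝 f) := by
  refine tendsto_nhds_iff_tendstoUniformly.2 fun k => ?_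
  have hb (c : (ℝ × ℝ) × (ℝ × ℝ)) : ∃ C, ∀ p, ‖iteratedFDeriv ℝ k (trigPoly c) p‖ ≤ C :=
    ((isTorusPeriodic_trigPoly c).iteratedFDeriv k).exists_norm_le
      ((contDiff_trigPoly c).continuous_iteratedFDeriv (by exact_mod_cast le_top))
  obtain ⟨C₁, h₁⟩ := hb ((1, 0), 0)
  obtain ⟨C₂, h₂⟩ := hb ((0, 1), 0)
  obtain ⟨C₃, h₃⟩ := hb (0, (1, 0))
  obtain ⟨C₄, h₄⟩ := hb (0, (0, 1))
  have hlin (c : (ℝ × ℝ) × (ℝ × ℝ)) (p : ℝ × ℝ) :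
      iteratedFDeriv ℝ k (addTrigPoly f c).toFun p = iteratedFDeriv ℝ k f.toFun p +
        (c.1.1 • iteratedFDeriv ℝ k (trigPoly ((1, 0), 0)) p +
          c.1.2 • iteratedFDeriv ℝ k (trigPoly ((0, 1), 0)) p +
          c.2.1 • iteratedFDeriv ℝ k (trigPoly (0, (1, 0))) p +
          c.2.2 • iteratedFDeriv ℝ k (trigPoly (0, (0, 1))) p) := by
    have e : (addTrigPoly f c).toFun = f.toFun + (c.1.1 • trigPoly ((1, 0), 0) +
        c.1.2 • trigPoly ((0, 1), 0) + c.2.1 • trigPoly (0, (1, 0)) +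
        c.2.2 • trigPoly (0, (0, 1))) := by
      funext q
      simp [addTrigPoly, trigPoly]
    have hs (d : (ℝ × ℝ) × (ℝ × ℝ)) : ContDiffAt ℝ k (trigPoly d) p :=
      ((contDiff_trigPoly d).of_le (by exact_mod_cast le_top)).contDiffAt
    have hf : ContDiffAt ℝ k f.toFun p :=
      (f.smooth.of_le (by exact_mod_cast le_top)).contDiffAt
    have s1 : ContDiffAt ℝ k (c.1.1 • trigPoly ((1, 0), 0)) p := (hs _).const_smul c.1.1
    have s2 : ContDiffAt ℝ k (c.1.2 • trigPoly ((0, 1), 0)) p := (hs _).const_smul c.1.2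
    have s3 : ContDiffAt ℝ k (c.2.1 • trigPoly (0, (1, 0))) p := (hs _).const_smul c.2.1
    have s4 : ContDiffAt ℝ k (c.2.2 • trigPoly (0, (0, 1))) p := (hs _).const_smul c.2.2
    have s12 : ContDiffAt ℝ k (c.1.1 • trigPoly ((1, 0), 0) + c.1.2 • trigPoly ((0, 1), 0)) p :=
      s1.add s2
    have s123 : ContDiffAt ℝ k (c.1.1 • trigPoly ((1, 0), 0) + c.1.2 • trigPoly ((0, 1), 0) +
      c.2.1 • trigPoly (0, (1, 0))) p := s12.add s3
    have s1234 : ContDiffAt ℝ k (c.1.1 • trigPoly ((1, 0), 0) + c.1.2 • trigPoly ((0, 1), 0) +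
      c.2.1 • trigPoly (0, (1, 0)) + c.2.2 • trigPoly (0, (0, 1))) p := s123.add s4
    rw [e, iteratedFDeriv_add_apply hf s1234,
      iteratedFDeriv_add_apply s123 s4, iteratedFDeriv_add_apply s12 s3,
      iteratedFDeriv_add_apply s1 s2, iteratedFDeriv_const_smul_apply (hs _),
      iteratedFDeriv_const_smul_apply (hs _), iteratedFDeriv_const_smul_apply (hs _),
      iteratedFDeriv_const_smul_apply (hs _)]
  have hlim : Tendsto (fun c : (ℝ × ℝ) × (ℝ × ℝ) =>
      ‖c.1.1‖ * C₁ + ‖c.1.2‖ * C₂ + ‖c.2.1‖ * C₃ + ‖c.2.2‖ * C₄) (𝓝 0) (𝓝 0) := by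
    have : Continuous fun c : (ℝ × ℝ) × (ℝ × ℝ) =>
      ‖c.1.1‖ * C₁ + ‖c.1.2‖ * C₂ + ‖c.2.1‖ * C₃ + ‖c.2.2‖ * C₄ := by fun_prop
    simpa using this.tendsto 0
  refine Metric.tendstoUniformly_iff.2 fun δ hδ => ?_
  filter_upwards [hlim.eventually_lt_const hδ] with c hc p
  rw [hlin, dist_self_add_right]
  refine lt_of_le_of_lt ?_ hc
  refine (norm_add_le _ _).trans (add_le_add ((norm_add_le _ _).trans (add_le_add
    ((norm_add_le _ _).trans (add_le_add ?_ ?_)) ?_)) ?_) <;> rw [norm_smul]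
  · exact mul_le_mul_of_nonneg_left (h₁ p) (norm_nonneg _)
  · exact mul_le_mul_of_nonneg_left (h₂ p) (norm_nonneg _)
  · exact mul_le_mul_of_nonneg_left (h₃ p) (norm_nonneg _)
  · exact mul_le_mul_of_nonneg_left (h₄ p) (norm_nonneg _)

/-- The pairs `(p, c)` such that `p` solves the system of `addTrigPoly f c` are those with
`c = zeroParam f (p, t)` for some `t`: each of the two equations is linear in two of the
coefficients, and its solutions form a line that `t` parametrizes. -/
noncomputable def zeroParam (f : SmoothTorusFunction) (x : (ℝ × ℝ) × (ℝ × ℝ)) :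
    (ℝ × ℝ) × (ℝ × ℝ) :=
  ((-(operatorU f.toFun x.1 / 6) * Real.sin (2 * x.1.1) + x.2.1 * Real.cos (2 * x.1.1),
    operatorU f.toFun x.1 / 6 * Real.cos (2 * x.1.1) + x.2.1 * Real.sin (2 * x.1.1)),
   (-(operatorV f.toFun x.1 / 6) * Real.sin (2 * x.1.2) + x.2.2 * Real.cos (2 * x.1.2),
    operatorV f.toFun x.1 / 6 * Real.cos (2 * x.1.2) + x.2.2 * Real.sin (2 * x.1.2)))

theorem contDiff_zeroParam (f : SmoothTorusFunction) : ContDiff ℝ ∞ (zeroParam f) := by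
  have hU := contDiff_operatorU f.smooth
  have hV := contDiff_operatorV f.smooth
  unfold zeroParam
  fun_prop

/-- One half of the statement that, at a solution `p` of the system of `addTrigPoly f c`, a vector
in the kernel of the Jacobian yields a vector in the kernel of the derivative of `zeroParam f`.
Here `F` is `operatorU f` or `operatorV f` along the line through `p` in the direction of the former
vector, `u` and `w` are the corresponding coordinates of `p` and of the vector, and `a`, `b` are two
of the coefficients. The slope `F 0 * w / 3` of the parameter `t` cancels the contribution of the
rotation of the vectors `(-sin 2u, cos 2u)` that multiply `F / 6`. -/
theorem hasDerivAt_zeroParam_line {F : ℝ → ℝ} {F' u w a b : ℝ} (hF : HasDerivAt F F' 0)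
    (h1 : F' + 12 * w * (a * Real.cos (2 * u) + b * Real.sin (2 * u)) = 0) :
    HasDerivAt (fun r : ℝ =>
      (-(F r / 6) * Real.sin (2 * (u + r * w)) + ((a * Real.cos (2 * u) + b * Real.sin (2 * u)) +
          r * (F 0 * w / 3)) * Real.cos (2 * (u + r * w)),
        F r / 6 * Real.cos (2 * (u + r * w)) + ((a * Real.cos (2 * u) + b * Real.sin (2 * u)) +
          r * (F 0 * w / 3)) * Real.sin (2 * (u + r * w)))) ((0 : ℝ), (0 : ℝ)) 0 := by
  have hl : HasDerivAt (fun r : ℝ => 2 * (u + r * w)) (2 * w) 0 := by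
    simpa using (((hasDerivAt_id (0 : ℝ)).mul_const w).const_add u).const_mul 2
  have ht : HasDerivAt (fun r : ℝ => (a * Real.cos (2 * u) + b * Real.sin (2 * u)) +
      r * (F 0 * w / 3)) (F 0 * w / 3) 0 := by
    simpa using ((hasDerivAt_id (0 : ℝ)).mul_const (F 0 * w / 3)).const_add
      (a * Real.cos (2 * u) + b * Real.sin (2 * u))
  have hF6 := hF.div_const 6
  have hF6n : HasDerivAt (fun r : ℝ => -(F r / 6)) (-(F' / 6)) 0 := hF6.neg
  refine HasDerivAt.prodMk (((hF6n.mul hl.sin).add (ht.mul hl.cos)).congr_deriv ?_)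
    (((hF6.mul hl.cos).add (ht.mul hl.sin)).congr_deriv ?_)
  · simp only [zero_mul, add_zero]
    linear_combination (-(Real.sin (2 * u)) / 6) * h1
  · simp only [zero_mul, add_zero]
    linear_combination (Real.cos (2 * u) / 6) * h1

/-- If `c` is not a critical value of `zeroParam f`, then `addTrigPoly f c` is generic. -/
theorem hasSimpleSolutions_of_not_mem_image (f : SmoothTorusFunction) {c : (ℝ × ℝ) × (ℝ × ℝ)}
    (hc : c ∉ zeroParam f '' {x | (fderiv ℝ (zeroParam f) x).det = 0}) :
    HasSimpleSolutions (addTrigPoly f c).toFun := by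
  rintro p ⟨-, hU, hV⟩ hdet
  set g := addTrigPoly f c with hg
  -- A nonzero vector `w` in the kernel of the Jacobian.
  obtain ⟨w, hw, hw0⟩ : ∃ w, fderiv ℝ (fun q : ℝ × ℝ => (operatorU g.toFun q, operatorV g.toFun q))
      p w = 0 ∧ w ≠ 0 := by
    by_contra! hcon
    refine (?_ : ¬ IsUnit _) ((LinearMap.isUnit_iff_ker_eq_bot _).2 (LinearMap.ker_eq_bot'.2 hcon))
    rw [LinearMap.isUnit_iff_isUnit_det]
    simpa [ContinuousLinearMap.det] using hdet
  have hline : HasDerivAt (fun r : ℝ => p + r • w) w 0 := by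
    simpa using ((hasDerivAt_id (0 : ℝ)).smul_const w).const_add p
  have hcomp {φ : ℝ × ℝ → ℝ} (hφ : ContDiff ℝ ∞ φ) :
      HasDerivAt (fun r : ℝ => φ (p + r • w)) (fderiv ℝ φ p w) 0 := by
    have h1 : HasFDerivAt φ (fderiv ℝ φ p) (p + (0 : ℝ) • w) := by
      simpa using (hφ.differentiable (by simp) p).hasFDerivAt
    exact h1.comp_hasDerivAt 0 hline
  have hker : fderiv ℝ (operatorU g.toFun) p w = 0 ∧ fderiv ℝ (operatorV g.toFun) p w = 0 := by
    rw [DifferentiableAt.fderiv_prodMk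
      ((contDiff_operatorU g.smooth).differentiable (by simp) p)
      ((contDiff_operatorV g.smooth).differentiable (by simp) p)] at hw
    exact ⟨congrArg Prod.fst hw, congrArg Prod.snd hw⟩
  have dU := hcomp (contDiff_operatorU f.smooth)
  have dV := hcomp (contDiff_operatorV f.smooth)
  have htrig (a b u z : ℝ) : HasDerivAt (fun r : ℝ => 6 * (a * Real.sin (2 * (u + r * z)) -
      b * Real.cos (2 * (u + r * z)))) (12 * z * (a * Real.cos (2 * u) + b * Real.sin (2 * u)))
      0 := by
    have hl : HasDerivAt (fun r : ℝ => 2 * (u + r * z)) (2 * z) 0 := by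
      simpa using (((hasDerivAt_id (0 : ℝ)).mul_const z).const_add u).const_mul 2
    exact (((hl.sin.const_mul a).sub (hl.cos.const_mul b)).const_mul 6).congr_deriv (by
      simp only [zero_mul, add_zero]; ring)
  have eU : fderiv ℝ (operatorU f.toFun) p w +
      12 * w.1 * (c.1.1 * Real.cos (2 * p.1) + c.1.2 * Real.sin (2 * p.1)) = 0 := by
    have hsum := (dU.add (htrig c.1.1 c.1.2 p.1 w.1)).congr_of_eventuallyEq
      (f₁ := fun r : ℝ => operatorU g.toFun (p + r • w))
      (Eventually.of_forall fun r => by simp [hg, operatorU_addTrigPoly])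
    exact (hsum.unique (hcomp (contDiff_operatorU g.smooth))).trans hker.1
  have eV : fderiv ℝ (operatorV f.toFun) p w +
      12 * w.2 * (c.2.1 * Real.cos (2 * p.2) + c.2.2 * Real.sin (2 * p.2)) = 0 := by
    have hsum := (dV.add (htrig c.2.1 c.2.2 p.2 w.2)).congr_of_eventuallyEq
      (f₁ := fun r : ℝ => operatorV g.toFun (p + r • w))
      (Eventually.of_forall fun r => by simp [hg, operatorV_addTrigPoly])
    exact (hsum.unique (hcomp (contDiff_operatorV g.smooth))).trans hker.2
  rw [hg, operatorU_addTrigPoly] at hU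
  rw [hg, operatorV_addTrigPoly] at hV
  have kU := hasDerivAt_zeroParam_line dU eU
  have kV := hasDerivAt_zeroParam_line dV eV
  set x : (ℝ × ℝ) × (ℝ × ℝ) := (p, (c.1.1 * Real.cos (2 * p.1) + c.1.2 * Real.sin (2 * p.1),
    c.2.1 * Real.cos (2 * p.2) + c.2.2 * Real.sin (2 * p.2))) with hx
  -- A vector over `w` in the kernel of the derivative of `zeroParam f`.
  set y : (ℝ × ℝ) × (ℝ × ℝ) :=
    (w, (operatorU f.toFun p * w.1 / 3, operatorV f.toFun p * w.2 / 3)) with hy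
  have hzero : fderiv ℝ (zeroParam f) x y = 0 := by
    have hl : HasDerivAt (fun r : ℝ => x + r • y) y 0 := by
      simpa using ((hasDerivAt_id (0 : ℝ)).smul_const y).const_add x
    have h1 : HasFDerivAt (zeroParam f) (fderiv ℝ (zeroParam f) x) (x + (0 : ℝ) • y) := by
      simpa using ((contDiff_zeroParam f).differentiable (by simp) x).hasFDerivAt
    refine (h1.comp_hasDerivAt 0 hl).unique ((kU.prodMk kV).congr_of_eventuallyEq
      (Eventually.of_forall fun r => ?_))
    simp [zeroParam, hx, hy]
  have hxc : zeroParam f x = c := by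
    have s1 := Real.sin_sq_add_cos_sq (2 * p.1)
    have s2 := Real.sin_sq_add_cos_sq (2 * p.2)
    simp only [zeroParam, hx]
    refine Prod.ext (Prod.ext ?_ ?_) (Prod.ext ?_ ?_) <;> simp only
    · linear_combination (-(Real.sin (2 * p.1)) / 6) * hU + c.1.1 * s1
    · linear_combination (Real.cos (2 * p.1) / 6) * hU + c.1.2 * s1
    · linear_combination (-(Real.sin (2 * p.2)) / 6) * hV + c.2.1 * s2
    · linear_combination (Real.cos (2 * p.2) / 6) * hV + c.2.2 * s2
  refine hc ⟨x, ?_, hxc⟩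
  by_contra hne
  exact hw0 (congrArg Prod.fst (eq_zero_of_det_ne_zero hne hzero))

/-- By Sard's theorem for maps between spaces of the same dimension, almost every trigonometric
perturbation is generic. -/
theorem dense_hasSimpleSolutions :
    Dense {f : SmoothTorusFunction | HasSimpleSolutions f.toFun} := by
  intro f
  set μ : MeasureTheory.Measure ((ℝ × ℝ) × (ℝ × ℝ)) := MeasureTheory.Measure.addHaar
  have hnull : μ (zeroParam f '' {x | (fderiv ℝ (zeroParam f) x).det = 0}) = 0 :=
    MeasureTheory.addHaar_image_eq_zero_of_det_fderivWithin_eq_zero μ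
      (fun x _ => ((contDiff_zeroParam f).differentiable
        (by simp) x).hasFDerivAt.hasFDerivWithinAt) fun x hx => hx
  set S := (zeroParam f '' {x | (fderiv ℝ (zeroParam f) x).det = 0})ᶜ with hS
  have hdense : Dense S := MeasureTheory.Measure.dense_of_ae
    (MeasureTheory.measure_eq_zero_iff_ae_notMem.1 hnull)
  have : (𝓝[S] (0 : (ℝ × ℝ) × (ℝ × ℝ))).NeBot := mem_closure_iff_nhdsWithin_neBot.1 (hdense 0)
  exact mem_closure_of_tendsto (b := 𝓝[S] 0)
    ((tendsto_addTrigPoly f).mono_left nhdsWithin_le_nhds)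
    ((eventually_mem_nhdsWithin (s := S)).mono fun c hc => hasSimpleSolutions_of_not_mem_image f hc)

end HyperboloidPerturbation

theorem mainTheorem3 :
    IsOpen {f : HyperboloidPerturbation.SmoothTorusFunction |
      HyperboloidPerturbation.HasSimpleSolutions f.toFun} ∧
    Dense {f : HyperboloidPerturbation.SmoothTorusFunction |
      HyperboloidPerturbation.HasSimpleSolutions f.toFun} ∧
    ∀ f : HyperboloidPerturbation.SmoothTorusFunction,
      HyperboloidPerturbation.HasSimpleSolutions f.toFun →
        (HyperboloidPerturbation.solutionSet f.toFun).Finite ∧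
        ∃ ε₀ : ℝ, 0 < ε₀ ∧ ∀ ε : ℝ, ε ≠ 0 → |ε| ≤ ε₀ →
          {m | HyperboloidPerturbation.IsQuadraticPoint
            (HyperboloidPerturbation.perturbedSurface f.toFun ε) m}.encard =
          (HyperboloidPerturbation.solutionSet f.toFun).encard := by
  refine ⟨HyperboloidPerturbation.isOpen_hasSimpleSolutions,
    HyperboloidPerturbation.dense_hasSimpleSolutions, fun f hf => ?_⟩
  obtain ⟨hfin, hev⟩ := HyperboloidPerturbation.finite_solutionSet_and_eventually_encard_eq hf
  refine ⟨hfin, ?_⟩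
  obtain ⟨δ, hδ, hball⟩ := Metric.eventually_nhds_iff_ball.1 hev
  refine ⟨δ / 2, half_pos hδ, fun ε hε hle => hball ε ?_ hε⟩
  rw [mem_ball_zero_iff, Real.norm_eq_abs]
  linarith
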